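/- **Setting.** Let $d,N_D\ge 1$, let $f:\mathbb R^d\times\mathbb R^p\to\mathbb R$ and $\vec c_1,\dots,\vec c_{N_D}\in\mathbb R^p$ be such that every $f(\cdot,\vec c_k)$ is twice differentiable, and put $F(\vec a)=\frac1{N_D}\sum_{k=1}^{N_D}f(\vec a,\vec c_k)$, with gradient $\vec g_F$, Hessian $H_F$ and minimizer $\vec a^\star$. Write $f_i=\partial f/\partial a_i$ and $f_{ij}=\partial^2 f/\partial a_i\partial a_j$. Let $\mu,M,\varepsilon,B>0$ and suppose that * $F(\vec a)\ge F(\vec b)+\vec g_F(\vec b)\cdot(\vec a-\vec b)+\frac\mu2\|\vec a-\vec b\|^2$ and $\|H_F(\vec a)-H_F(\vec b)\|\le M\|\vec a-\vec b\|$ for all $\vec a,\vec b\in\mathbb R^d$ (Euclidean and spectral norms); * $\frac{2M}{\mu}\varepsilon<1$, and $\vec a_0\in\mathbb R^d$ satisfies $\delta_0:=\|\vec a_0-\vec a^\star\|<\frac\mu M$; * $|f_i(\vec a,\vec c_k)|\le B$ and $|f_{ij}(\vec a,\vec c_k)|\le B$ for all $i,j,k$ and all $\vec a$ with $\|\vec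 a-\vec a^\star\|\le\tilde\delta_0$, where $\tilde\delta_0:=\max\{\delta_0,\delta_-\}$ and $\delta_-:=\frac\mu M\bigl(1-\sqrt{1-\frac{2M}\mu\varepsilon}\bigr)$. **Method.** The data are accessible only through the quantum oracles $P_c:|k\rangle|0\rangle\mapsto|k\rangle|\vec c_k\rangle$, $P_i:|\vec a\rangle|\vec c\rangle|0\rangle\mapsto|\vec a\rangle|\vec c\rangle|f_i(\vec a,\vec c)\rangle$ and $P_{ij}:|\vec a\rangle|\vec c\rangle|0\rangle\mapsto|\vec a\rangle|\vec c\rangle|f_{ij}(\vec a,\vec c)\rangle$ and their inverses, registers being exact. An average $\frac1{N_D}\sum_k v_k$, with $v_k=f_i(\vec a,\vec c_k)$ or $v_k=f_{ij}(\vec a,\vec c_k)$, is estimated by quantum amplitude estimation (QAE): with $A$ the circuit (one call to $P_c$ and one to $P_i$ or $P_{ij}$) that prepares $$\frac1{\sqrt{N_D}}\sum_k|\vec a\rangle|k\rangle|\vec c_k\rangle|v_k\rangle\bigl(\sqrt{1-q_k}\,|0\rangle+\sqrt{q_k}\,|1\rangle\bigr),\qquad q_k=\tfrac12(1+v_k/B)$$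 (with $q_k$ truncated to $[0,1]$), phase estimation for $Q=-AS_0A^{-1}S_\Psi$ on $T+1$ points, using $Q$ $T$ times, gives an outcome $y$ and the estimate $\sin^2(\pi y/(T+1))$ of the probability of the last qubit being $1$; the median $\hat q$ of an odd number of such runs gives the estimate $B(2\hat q-1)$. The QAE-based Newton's method iterates $\vec a_{n+1}=\vec a_n-\hat H_F(\vec a_n)^{-1}\hat{\vec g}_F(\vec a_n)$, where all components of $\hat{\vec g}_F$ and $\hat H_F$ are estimated in this way (a run in which $\hat H_F$ is singular counts as a failure). Its parameters are $T$ and the number of repetitions, for the gradient and for the Hessian. **Theorem.** There is a universal constant $K>0$ such that, for suitable parameters of the method that depend only on $d,\mu,M,\varepsilon,\delta_0,B$ (not on $N_D$, $p$, $f$, the $\vec c_k$, or $\vec a_0$), after $$n_{\rm it}=\max\left\{\left\lceil\log_2\frac{\log(2M\varepsilon/\mu)}{2\log(M\delta_0/\mu)}\right\rceil+1,\;1\right\}$$ updates ($n_{\rm it}=1$ if $\delta_0=0$) the QAE-based Newton's method returns $\vec a_{n_{\rm it}}$ with $\|\vec a_{n_{\rm it}}-\vec a^\star\|\le2\varepsilon$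 with probability greater than $99\%$. In every run, the total numbers $N_{\rm 1stDer}$, $N_{\rm 2ndDer}$ and $N_c$ of calls to the $P_i$, to the $P_{ij}$ and to $P_c$ (inverses included) satisfy $$N_{\rm 1stDer}\le K\,\frac{B\,d^{3/2}}{\mu\varepsilon}\,n_{\rm it}\,\Lambda,\qquad N_{\rm 2ndDer}\le K\,\frac{B\,\tilde\delta_0\,d^{3}}{\mu\varepsilon}\,n_{\rm it}\,\Lambda,\qquad N_c=N_{\rm 1stDer}+N_{\rm 2ndDer},$$ where $\Lambda=\max\{1,\log(n_{\rm it}d^2)\}$. -/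

import Mathlib

open Real

noncomputable section

namespace QAENewton

/-! ### The optimization problem -/

/-- The space `ℝ^d` of optimization variables, with the Euclidean norm. -/
abbrev Pt (d : ℕ) := EuclideanSpace ℝ (Fin d)

/-- The space `ℝ^p` of parameter vectors. -/
abbrev Par (p : ℕ) := Fin p → ℝ

/-- The names of the derivatives `f_i = ∂f/∂a_i` and `f_ij = ∂²f/∂a_i∂a_j`. -/
inductive Target (d : ℕ) where
  | first (i : Fin d)
  | second (i j : Fin d)

/-- The partial derivatives of `a ↦ f a c`. -/
def partialDeriv {d p : ℕ} (f : Pt d → Par p → ℝ) : Target d → Pt d → Par p → ℝ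
  | .first i => fun a c => fderiv ℝ (fun x => f x c) a (EuclideanSpace.single i 1)
  | .second i j => fun a c =>
      fderiv ℝ (fun y => fderiv ℝ (fun x => f x c) y (EuclideanSpace.single j 1)) a
        (EuclideanSpace.single i 1)

/-- `F(a) = (1/N) ∑_k f(a, c_k)`. -/
def objective {d p N : ℕ} (f : Pt d → Par p → ℝ) (c : Fin N → Par p) (a : Pt d) : ℝ :=
  (1 / (N : ℝ)) * ∑ k, f a (c k)

def TwiceDifferentiable {d : ℕ} (F : Pt d → ℝ) : Prop :=
  Differentiable ℝ F ∧ Differentiable ℝ (fderiv ℝ F)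

/-- `μ`-strong convexity of a differentiable function. -/
def StronglyConvex {d : ℕ} (μ : ℝ) (F : Pt d → ℝ) : Prop :=
  ∀ a b, F a ≥ F b + inner ℝ (gradient F b) (a - b) + μ / 2 * ‖a - b‖ ^ 2

/-- The Hessian as a linear operator on `ℝ^d`; its operator norm is the spectral norm. -/
def hessian {d : ℕ} (F : Pt d → ℝ) (a : Pt d) : Pt d →L[ℝ] Pt d :=
  fderiv ℝ (gradient F) a

def LipschitzHessian {d : ℕ} (M : ℝ) (F : Pt d → ℝ) : Prop :=
  ∀ a b, ‖hessian F a - hessian F b‖ ≤ M * ‖a - b‖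

/-- `δ₋ = (μ/M)(1 - √(1 - 2Mε/μ))`. -/
def deltaMinus (μ M ε : ℝ) : ℝ := μ / M * (1 - √(1 - 2 * M / μ * ε))

/-- `δ̃₀ = max{δ₀, δ₋}`. -/
def deltaTilde (μ M ε δ₀ : ℝ) : ℝ := max δ₀ (deltaMinus μ M ε)

/-- The number of Newton updates,
`max{⌈log₂(log(2Mε/μ) / (2 log(Mδ₀/μ)))⌉ + 1, 1}`. For `δ₀ = 0` it is `1`. -/
def numIter (μ M ε δ₀ : ℝ) : ℕ :=
  (max (⌈logb 2 (log (2 * M * ε / μ) / (2 * log (M * δ₀ / μ)))⌉ + 1) 1).toNat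

/-! ### Quantum circuits with oracle gates -/

/-- Labels of the computational basis states
`|phase⟩|a⟩|k⟩|c⟩|value⟩|flag⟩`. Registers holding real numbers are exact; `phase` is the register
of size `T + 1` that amplitude estimation measures. -/
structure Label (d p N T : ℕ) where
  phase : Fin (T + 1)
  pt : Pt d
  idx : Fin N
  par : Par p
  val : ℝ
  flag : Bool

/-- Finite superpositions of computational basis states. -/
abbrev State (d p N T : ℕ) := Label d p N T →₀ ℂ

abbrev ket {d p N T : ℕ} (e : Label d p N T) : State d p N T := Finsupp.single e 1

/-- Elementary gates. The flag `inv` selects the inverse gate. -/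
inductive Gate (d : ℕ) where
  /-- Fourier transform of the phase register -/
  | fourierPhase (inv : Bool)
  /-- Fourier transform of the index register -/
  | fourierIdx (inv : Bool)
  /-- the oracle `P_c : |k⟩|0⟩ ↦ |k⟩|c_k⟩` -/
  | queryPar (inv : Bool)
  /-- the oracles `P_i : |a⟩|c⟩|0⟩ ↦ |a⟩|c⟩|f_i(a, c)⟩` and `P_ij`, likewise with `f_ij` -/
  | queryDeriv (t : Target d) (inv : Bool)
  /-- rotation of the flag qubit, controlled by the value register -/
  | rotate (inv : Bool)
  /-- sign change of the states with flag `1`, executed if the phase register exceeds `n` -/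
  | signFlag (n : ℕ)
  /-- sign change of the states that are not `0` on index, parameter, value and flag registers,
  executed if the phase register exceeds `n` -/
  | signNonzero (n : ℕ)

/-- Entries of the unitary discrete Fourier transform on `n` points, or of its inverse. -/
def fourierCoeff (n : ℕ) (inv : Bool) (x y : Fin n) : ℂ :=
  (1 / √(n : ℝ) : ℝ) *
    Complex.exp ((if inv then -1 else 1) * (2 * π * Complex.I * (x : ℕ) * (y : ℕ) / n))

/-- The affine encoding of `v ∈ [-B, B]` as a probability (truncated outside this range). -/
def encode (B v : ℝ) : ℝ := max 0 (min 1 ((1 + v / B) / 2))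

/-- Amplitude of `|y⟩` in the image of `|x⟩` under the rotation
`|0⟩ ↦ √(1-q)|0⟩ + √q|1⟩`, `|1⟩ ↦ -√q|0⟩ + √(1-q)|1⟩`, or its inverse. -/
def rotCoeff (q : ℝ) (inv : Bool) (x y : Bool) : ℝ :=
  if x = y then √(1 - q) else if x = inv then √q else -√q

/-! ### Inner product and norm of finite superpositions -/

section InnerProduct

variable {L : Type*}

/-- The inner product of two finite superpositions. -/
def dot (φ ψ : L →₀ ℂ) : ℂ := φ.sum fun e z => starRingEnd ℂ z * ψ e

theorem dot_add_left (φ φ' ψ : L →₀ ℂ) : dot (φ + φ') ψ = dot φ ψ + dot φ' ψ :=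
  Finsupp.sum_add_index' (by simp) (by intros; simp [add_mul])

theorem dot_add_right (φ ψ ψ' : L →₀ ℂ) : dot φ (ψ + ψ') = dot φ ψ + dot φ ψ' := by
  simp [dot, mul_add]

theorem dot_smul_left (z : ℂ) (φ ψ : L →₀ ℂ) : dot (z • φ) ψ = starRingEnd ℂ z * dot φ ψ := by
  unfold dot
  rw [Finsupp.sum_smul_index' (by simp), Finsupp.mul_sum]
  simp [mul_assoc]

theorem dot_smul_right (z : ℂ) (φ ψ : L →₀ ℂ) : dot φ (z • ψ) = z * dot φ ψ := by
  unfold dot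
  rw [Finsupp.mul_sum]
  simp [mul_left_comm]

theorem dot_zero_left (ψ : L →₀ ℂ) : dot 0 ψ = 0 := by simp [dot]

theorem dot_zero_right (φ : L →₀ ℂ) : dot φ 0 = 0 := by simp [dot]

open Classical in
theorem dot_single (e e' : L) :
    dot (Finsupp.single e 1) (Finsupp.single e' 1) = if e = e' then 1 else 0 := by
  simp [dot, Finsupp.single_apply, eq_comm]

theorem dot_sum_left {ι : Type*} (s : Finset ι) (φ : ι → L →₀ ℂ) (ψ : L →₀ ℂ) :
    dot (∑ x ∈ s, φ x) ψ = ∑ x ∈ s, dot (φ x) ψ := by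
  classical
  induction s using Finset.induction_on with
  | empty => simp [dot_zero_left]
  | insert a s ha ih => simp [Finset.sum_insert ha, dot_add_left, ih]

theorem dot_sum_right {ι : Type*} (s : Finset ι) (φ : L →₀ ℂ) (ψ : ι → L →₀ ℂ) :
    dot φ (∑ x ∈ s, ψ x) = ∑ x ∈ s, dot φ (ψ x) := by
  classical
  induction s using Finset.induction_on with
  | empty => simp [dot_zero_right]
  | insert a s ha ih => simp [Finset.sum_insert ha, dot_add_right, ih]

theorem dot_self (ψ : L →₀ ℂ) : dot ψ ψ = ((∑ e ∈ ψ.support, ‖ψ e‖ ^ 2 : ℝ) : ℂ) := by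
  unfold dot Finsupp.sum
  push_cast
  exact Finset.sum_congr rfl fun e _ => by rw [Complex.conj_mul']

open Classical in
/-- A linear map that sends the basis states to an orthonormal family preserves inner products. -/
theorem dot_linearCombination (u : L → L →₀ ℂ)
    (hu : ∀ e e', dot (u e) (u e') = if e = e' then 1 else 0) (φ ψ : L →₀ ℂ) :
    dot (Finsupp.linearCombination ℂ u φ) (Finsupp.linearCombination ℂ u ψ) = dot φ ψ := by
  induction φ using Finsupp.induction_linear with
  | zero => simp [dot_zero_left]
  | add φ φ' h h' => simp [dot_add_left, h, h']
  | single e z =>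
    induction ψ using Finsupp.induction_linear with
    | zero => simp [dot_zero_right]
    | add ψ ψ' h h' => simp only [map_add, dot_add_right, h, h']
    | single e' z' =>
      rw [← Finsupp.smul_single_one e z, ← Finsupp.smul_single_one e' z', map_smul, map_smul,
        Finsupp.linearCombination_single, Finsupp.linearCombination_single, one_smul, one_smul,
        dot_smul_left, dot_smul_left, dot_smul_right, dot_smul_right, hu, dot_single]

end InnerProduct

section Semantics

variable {d p N T : ℕ}

/-- The action of a gate on the computational basis states, for the problem given by `f` and `c`.
An oracle adds the value of its function to the output register. -/
def Gate.onKet [NeZero N] (f : Pt d → Par p → ℝ) (c : Fin N → Par p) (B : ℝ) :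
    Gate d → Label d p N T → State d p N T
  | .fourierPhase inv, e => ∑ y, fourierCoeff (T + 1) inv e.phase y • ket { e with phase := y }
  | .fourierIdx inv, e => ∑ k, fourierCoeff N inv e.idx k • ket { e with idx := k }
  | .queryPar inv, e =>
      ket { e with par := if inv then e.par - c e.idx else e.par + c e.idx }
  | .queryDeriv t inv, e =>
      ket { e with val := if inv then e.val - partialDeriv f t e.pt e.par
                          else e.val + partialDeriv f t e.pt e.par }
  | .rotate inv, e =>
      ∑ y, (rotCoeff (encode B e.val) inv e.flag y : ℂ) • ket { e with flag := y }
  | .signFlag n, e => (if n < (e.phase : ℕ) ∧ e.flag = true then -1 else 1 : ℂ) • ket e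
  | .signNonzero n, e =>
      (if n < (e.phase : ℕ) ∧ ¬ (e.idx = 0 ∧ e.par = 0 ∧ e.val = 0 ∧ e.flag = false)
        then -1 else 1 : ℂ) • ket e

/-- The linear extension of `Gate.onKet`. -/
def Gate.apply [NeZero N] (f : Pt d → Par p → ℝ) (c : Fin N → Par p) (B : ℝ) (g : Gate d) :
    State d p N T →ₗ[ℂ] State d p N T :=
  Finsupp.linearCombination ℂ (g.onKet f c B)

/-- Execution of a circuit; the head of the list is the first gate. -/
def runCircuit [NeZero N] (f : Pt d → Par p → ℝ) (c : Fin N → Par p) (B : ℝ) :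
    List (Gate d) → State d p N T → State d p N T
  | [], ψ => ψ
  | g :: C, ψ => runCircuit f c B C (g.apply f c B ψ)

/-! ### The gates are isometries -/

theorem fourierCoeff_orthonormal (n : ℕ) (inv : Bool) (x x' : Fin n) :
    ∑ y, starRingEnd ℂ (fourierCoeff n inv x y) * fourierCoeff n inv x' y =
      if x = x' then 1 else 0 := by
  have hn : (n : ℂ) ≠ 0 := by exact_mod_cast x.pos.ne'
  obtain ⟨s, hs, hs'⟩ : ∃ s : ℤ, (s = 1 ∨ s = -1) ∧
      (if inv then -1 else 1 : ℂ) = (s : ℂ) := by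
    cases inv
    · exact ⟨1, by simp, by simp⟩
    · exact ⟨-1, by simp, by simp⟩
  set w : ℂ := Complex.exp (2 * π * Complex.I * ((s * ((x' : ℕ) - (x : ℕ) : ℤ) : ℤ) / n)) with hw
  have key : ∀ y : Fin n, starRingEnd ℂ (fourierCoeff n inv x y) * fourierCoeff n inv x' y =
      1 / n * w ^ (y : ℕ) := by
    intro y
    have h1 : ((1 / √(n : ℝ) : ℝ) : ℂ) * ((1 / √(n : ℝ) : ℝ) : ℂ) = 1 / n := by
      rw [← Complex.ofReal_mul, div_mul_div_comm, Real.mul_self_sqrt (Nat.cast_nonneg n)]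
      simp
    unfold fourierCoeff
    rw [hs', map_mul, Complex.conj_ofReal, ← Complex.exp_conj, mul_mul_mul_comm, h1,
      ← Complex.exp_add, hw, ← Complex.exp_nat_mul]
    congr 2
    simp only [map_mul, map_div₀, Complex.conj_ofReal, Complex.conj_I, map_natCast, map_intCast,
      map_ofNat]
    push_cast
    ring
  simp_rw [key]
  rw [← Finset.mul_sum, Fin.sum_univ_eq_sum_range (fun y => w ^ y)]
  split_ifs with h
  · have : w = 1 := by simp [hw, h]
    simp [this, hn]
  · have hwn : w ^ n = 1 := by
      rw [hw, ← Complex.exp_nat_mul, Complex.exp_eq_one_iff]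
      exact ⟨s * ((x' : ℕ) - (x : ℕ) : ℤ), by field_simp⟩
    have hw1 : w ≠ 1 := by
      intro hw1
      obtain ⟨m, hm⟩ := Complex.exp_eq_one_iff.1 hw1
      have hm' : ((s * ((x' : ℕ) - (x : ℕ) : ℤ) : ℤ) : ℂ) = ((m * n : ℤ) : ℂ) := by
        have h2 := Complex.two_pi_I_ne_zero
        rw [mul_comm (m : ℂ)] at hm
        have := mul_left_cancel₀ h2 hm
        rw [div_eq_iff hn] at this
        rw [this]
        push_cast
        rfl
      have hm2 : s * ((x' : ℕ) - (x : ℕ) : ℤ) = m * n := by exact_mod_cast hm'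
      have hlt := x.isLt
      have hlt' := x'.isLt
      have hdvd : (n : ℤ) ∣ ((x' : ℕ) - (x : ℕ) : ℤ) := by
        rcases hs with rfl | rfl
        · exact ⟨m, by linarith⟩
        · exact ⟨-m, by linarith⟩
      have h0 := Int.eq_zero_of_abs_lt_dvd hdvd (by rw [abs_lt]; constructor <;> omega)
      exact h (Fin.ext (by omega))
    have := mul_neg_geom_sum w n
    rw [hwn, sub_self] at this
    rcases mul_eq_zero.1 this with h3 | h3
    · exact absurd (sub_eq_zero.1 h3).symm hw1
    · rw [h3, mul_zero]

theorem rotCoeff_orthonormal (B v : ℝ) (inv : Bool) (x x' : Bool) :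
    ∑ y, starRingEnd ℂ (rotCoeff (encode B v) inv x y : ℂ) * (rotCoeff (encode B v) inv x' y : ℂ) =
      if x = x' then 1 else 0 := by
  have h0 : 0 ≤ encode B v := le_max_left _ _
  have h1 : 0 ≤ 1 - encode B v :=
    sub_nonneg.2 (max_le zero_le_one (min_le_left _ _))
  have e0 := Real.mul_self_sqrt h0
  have e1 := Real.mul_self_sqrt h1
  simp only [Complex.conj_ofReal, ← Complex.ofReal_mul, ← Complex.ofReal_sum, Fintype.sum_bool]
  cases inv <;> cases x <;> cases x' <;> simp [rotCoeff] <;> norm_cast <;> linarith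

open Classical in
/-- A unitary acting on one register `r`, controlled by the others: `set y e` is the label `e` with
content `y` in that register. -/
theorem dot_register {L ι : Type*} [Fintype ι] (r : L → ι) (set : ι → L → L)
    (coeff : L → ι → ι → ℂ)
    (hset : ∀ y y' e e', set y e = set y' e' → y = y' ∧ set (r e) e' = e)
    (hself : ∀ e, set (r e) e = e)
    (hcong : ∀ e e' y, set y e' = e → ∀ y', set y' e' = set y' e ∧ coeff e' = coeff e)
    (hcoeff : ∀ e x x', ∑ y, starRingEnd ℂ (coeff e x y) * coeff e x' y = if x = x' then 1 else 0)
    (e e' : L) :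
    dot (∑ y, coeff e (r e) y • (Finsupp.single (set y e) 1 : L →₀ ℂ))
      (∑ y, coeff e' (r e') y • (Finsupp.single (set y e') 1 : L →₀ ℂ)) =
      if e = e' then 1 else 0 := by
  simp only [dot_sum_left, dot_sum_right, dot_smul_left, dot_smul_right, dot_single]
  by_cases h : set (r e) e' = e
  · have hc := fun y' => hcong e e' _ h y'
    have hiff : e = e' ↔ r e = r e' := by
      constructor
      · rintro rfl; rfl
      · intro hr
        rw [← h, hr, hself]
    rw [if_congr hiff rfl rfl, ← hcoeff e (r e) (r e')]
    refine Finset.sum_congr rfl fun y _ => ?_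
    rw [Finset.sum_eq_single y]
    · rw [(hc y).1, (hc y).2]
      simp [mul_comm]
    · intro y' _ hy
      rw [if_neg (fun hh => hy (hset _ _ _ _ hh).1)]
      simp
    · simp
  · rw [if_neg (by rintro rfl; exact h (hself _))]
    refine Finset.sum_eq_zero fun y _ => mul_eq_zero_of_right _ (Finset.sum_eq_zero fun y' _ => ?_)
    rw [if_neg (fun hh => h (hset _ _ _ _ hh).2)]
    simp

open Classical in
theorem Gate.onKet_orthonormal [NeZero N] (f : Pt d → Par p → ℝ) (c : Fin N → Par p) (B : ℝ)
    (g : Gate d) (e e' : Label d p N T) :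
    dot (g.onKet f c B e) (g.onKet f c B e') = if e = e' then 1 else 0 := by
  cases g with
  | fourierPhase inv =>
    rw [Gate.onKet, Gate.onKet]
    refine dot_register (fun e : Label d p N T => e.phase) (fun y e => { e with phase := y })
      (fun _ => fourierCoeff (T + 1) inv) ?_ ?_ ?_ ?_ e e'
    · rintro y y' ⟨⟩ ⟨⟩ h
      simp_all
    · intro e; rfl
    · rintro e e' y rfl y'
      exact ⟨rfl, rfl⟩
    · intro e x x'
      convert fourierCoeff_orthonormal _ _ _ _
  | fourierIdx inv =>
    rw [Gate.onKet, Gate.onKet]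
    refine dot_register (fun e : Label d p N T => e.idx) (fun y e => { e with idx := y })
      (fun _ => fourierCoeff N inv) ?_ ?_ ?_ ?_ e e'
    · rintro y y' ⟨⟩ ⟨⟩ h
      simp_all
    · intro e; rfl
    · rintro e e' y rfl y'
      exact ⟨rfl, rfl⟩
    · intro e x x'
      convert fourierCoeff_orthonormal _ _ _ _
  | rotate inv =>
    rw [Gate.onKet, Gate.onKet]
    refine dot_register (fun e : Label d p N T => e.flag) (fun y e => { e with flag := y })
      (fun e x y => (rotCoeff (encode B e.val) inv x y : ℂ)) ?_ ?_ ?_ ?_ e e'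
    · rintro y y' ⟨⟩ ⟨⟩ h
      simp_all
    · intro e; rfl
    · rintro e e' y rfl y'
      exact ⟨rfl, rfl⟩
    · intro e x x'
      convert rotCoeff_orthonormal _ _ _ _ _
  | queryPar inv =>
    rw [Gate.onKet, Gate.onKet, dot_single]
    refine if_congr ⟨fun h => ?_, fun h => by rw [h]⟩ rfl rfl
    rcases e with ⟨⟩
    rcases e' with ⟨⟩
    cases inv <;> simp at h <;> obtain ⟨rfl, rfl, rfl, h, rfl, rfl⟩ := h <;> simp_all
  | queryDeriv t inv =>
    rw [Gate.onKet, Gate.onKet, dot_single]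
    refine if_congr ⟨fun h => ?_, fun h => by rw [h]⟩ rfl rfl
    rcases e with ⟨⟩
    rcases e' with ⟨⟩
    cases inv <;> simp at h <;> obtain ⟨rfl, rfl, rfl, rfl, h, rfl⟩ := h <;> simp_all
  | signFlag n =>
    rw [Gate.onKet, Gate.onKet, dot_smul_left, dot_smul_right, dot_single]
    by_cases h : e = e'
    · rw [h]
      split_ifs <;> simp
    · simp [h]
  | signNonzero n =>
    rw [Gate.onKet, Gate.onKet, dot_smul_left, dot_smul_right, dot_single]
    by_cases h : e = e'
    · rw [h]
      split_ifs <;> simp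
    · simp [h]

theorem dot_runCircuit [NeZero N] (f : Pt d → Par p → ℝ) (c : Fin N → Par p) (B : ℝ)
    (C : List (Gate d)) (ψ : State d p N T) :
    dot (runCircuit f c B C ψ) (runCircuit f c B C ψ) = dot ψ ψ := by
  induction C generalizing ψ with
  | nil => rfl
  | cons g C ih =>
    rw [runCircuit, ih]
    exact dot_linearCombination _ (g.onKet_orthonormal f c B) ψ ψ

/-- The Born rule: the probability to find `y` in the phase register. -/
def born (ψ : State d p N T) (y : Fin (T + 1)) : ℝ :=
  ∑ e ∈ ψ.support with e.phase = y, ‖ψ e‖ ^ 2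

theorem sum_born (ψ : State d p N T) (h : dot ψ ψ = 1) :
    ∑ y, ENNReal.ofReal (born ψ y) = 1 := by
  have h1 : ∑ y, born ψ y = 1 := by
    rw [dot_self] at h
    unfold born
    rw [Finset.sum_fiberwise]
    exact_mod_cast h
  rw [← ENNReal.ofReal_sum_of_nonneg, h1, ENNReal.ofReal_one]
  intro y _
  exact Finset.sum_nonneg fun e _ => by positivity

/-- The initial state: `|a⟩`, with `0` in all other registers. -/
def initLabel [NeZero N] (a : Pt d) : Label d p N T := ⟨0, a, 0, 0, 0, false⟩

/-- The law of the outcome when the phase register is measured after a run of the circuit `C`. -/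
def measurePhase [NeZero N] (f : Pt d → Par p → ℝ) (c : Fin N → Par p) (B : ℝ) (T : ℕ)
    (C : List (Gate d)) (a : Pt d) : PMF (Fin (T + 1)) :=
  PMF.ofFintype (fun y => ENNReal.ofReal (born (runCircuit f c B C (ket (initLabel a))) y))
    (sum_born _ (by rw [dot_runCircuit, dot_single, if_pos rfl]))

end Semantics

/-! ### Amplitude estimation -/

/-- The kinds of oracles whose calls are counted: `P_c`, the `P_i`, and the `P_ij`. -/
inductive OracleKind where
  | par
  | first
  | second

/-- Numbers of calls to the oracles of each kind. -/
abbrev Calls := OracleKind → ℕ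

/-- A gate makes at most one oracle call; an inverse oracle counts like the oracle. -/
def Gate.calls {d : ℕ} : Gate d → Calls
  | .queryPar _ => fun | .par => 1 | _ => 0
  | .queryDeriv (.first _) _ => fun | .first => 1 | _ => 0
  | .queryDeriv (.second _ _) _ => fun | .second => 1 | _ => 0
  | _ => fun _ => 0

def circuitCalls {d : ℕ} (C : List (Gate d)) : Calls := (C.map Gate.calls).sum

/-- The circuit `A : |a⟩|0⟩ ↦ N^{-1/2} ∑_k |a⟩|k⟩|c_k⟩|v_k⟩(√(1-q_k)|0⟩ + √q_k|1⟩)`, where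
`v_k` is the derivative `t` at `(a, c_k)` and `q_k = (1 + v_k/B)/2`. -/
def prepare {d : ℕ} (t : Target d) : List (Gate d) :=
  [.fourierIdx false, .queryPar false, .queryDeriv t false, .rotate false]

/-- The circuit `A⁻¹`. -/
def unprepare {d : ℕ} (t : Target d) : List (Gate d) :=
  [.rotate true, .queryDeriv t true, .queryPar true, .fourierIdx true]

/-- The operator `Q = -A S₀ A⁻¹ S_Ψ`, controlled by the condition that the phase register exceeds
`n` (otherwise the two sign changes are not executed, and the circuit is the identity). -/
def grover {d : ℕ} (t : Target d) (n : ℕ) : List (Gate d) :=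
  [.signFlag n] ++ unprepare t ++ [.signNonzero n] ++ prepare t

/-- Amplitude estimation with `T` uses of `Q`: on the part of the state where the phase register
is `j`, the operator `Q^j` is applied to `A|0⟩`. -/
def ampEst {d : ℕ} (t : Target d) (T : ℕ) : List (Gate d) :=
  [.fourierPhase false] ++ prepare t ++ (List.range T).flatMap (grover t) ++ [.fourierPhase true]

/-- Randomized computations that count their oracle calls. -/
abbrev Comp (α : Type) := StateT Calls PMF α

/-- One run of amplitude estimation: the outcome `y` gives the estimate `sin²(πy/(T+1))` of the
probability of the flag `1` in the state `A|0⟩`. -/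
def ampEstRun {d p N : ℕ} [NeZero N] (f : Pt d → Par p → ℝ) (c : Fin N → Par p) (B : ℝ)
    (t : Target d) (T : ℕ) (a : Pt d) : Comp ℝ := do
  modify (· + circuitCalls (ampEst t T))
  let y ← StateT.lift (measurePhase f c B T (ampEst t T) a)
  pure (sin (π * (y : ℕ) / (T + 1)) ^ 2)

/-- Execution of finitely many independent computations, one after the other. -/
def sampleVec {α : Type} : {n : ℕ} → (Fin n → Comp α) → Comp (Fin n → α)
  | 0, _ => pure Fin.elim0
  | _ + 1, q => do
      let x ← q 0
      let v ← sampleVec fun i => q i.succ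
      pure (Fin.cons x v)

/-- The median of `2s + 1` numbers. -/
def median {s : ℕ} (v : Fin (2 * s + 1) → ℝ) : ℝ := v (Tuple.sort v ⟨s, by omega⟩)

/-- The estimate of `(1/N) ∑_k v_k`, with `v_k` the derivative `t` at `(a, c_k)`: the median of
`2s + 1` runs of amplitude estimation, decoded from `[0, 1]` to `[-B, B]`. -/
def estimate {d p N : ℕ} [NeZero N] (f : Pt d → Par p → ℝ) (c : Fin N → Par p) (B : ℝ)
    (T s : ℕ) (a : Pt d) (t : Target d) : Comp ℝ := do
  let v ← sampleVec fun _ : Fin (2 * s + 1) => ampEstRun f c B t T a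
  pure (B * (2 * median v - 1))

/-! ### Newton's method -/

/-- The parameters of the method: numbers of uses of `Q` in a run of amplitude estimation, and
numbers of repetitions (`2 * rep + 1` runs), for components of the gradient and of the Hessian. -/
structure Params where
  usesGrad : ℕ
  repGrad : ℕ
  usesHess : ℕ
  repHess : ℕ

open Classical in
/-- One update `a ↦ a - Ĥ⁻¹ ĝ` with estimated gradient and Hessian. It fails if `Ĥ` is singular. -/
def newtonStep {d p N : ℕ} [NeZero N] (f : Pt d → Par p → ℝ) (c : Fin N → Par p) (B : ℝ)
    (P : Params) (a : Pt d) : Comp (Option (Pt d)) := do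
  let g ← sampleVec fun i => estimate f c B P.usesGrad P.repGrad a (.first i)
  let H ← sampleVec fun i => sampleVec fun j =>
    estimate f c B P.usesHess P.repHess a (.second i j)
  pure (if IsUnit (Matrix.of H) then some (a - WithLp.toLp 2 ((Matrix.of H)⁻¹.mulVec g)) else none)

/-- `n` updates. -/
def newtonIterate {d p N : ℕ} [NeZero N] (f : Pt d → Par p → ℝ) (c : Fin N → Par p) (B : ℝ)
    (P : Params) : ℕ → Pt d → Comp (Option (Pt d))
  | 0, a => pure (some a)
  | n + 1, a => do
      match ← newtonStep f c B P a with
      | some a' => newtonIterate f c B P n a'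
      | none => pure none

/-- The joint law of the result of `n` updates from `a₀` and the numbers of oracle calls. -/
def newtonLaw {d p N : ℕ} [NeZero N] (f : Pt d → Par p → ℝ) (c : Fin N → Par p) (B : ℝ)
    (P : Params) (n : ℕ) (a₀ : Pt d) : PMF (Option (Pt d) × Calls) :=
  (newtonIterate f c B P n a₀).run 0

end QAENewton

end

open QAENewton

/-! The proof joins a quantum estimate, a probabilistic amplification and a perturbed Newton
iteration.

Fix phase `j` and point `a`. Then `signNonzero` is a reflection about one basis state, so `grover`
is a product of two reflections in the plane of the two flag branches of `A|0⟩`. If `sin² θ` is the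
flag probability, the branch amplitudes of `Q^j A|0⟩` are `cos((2j+1)θ)` and `sin((2j+1)θ)`
(`groverCoeff_eq`). The inverse Fourier transform turns them into Fejér kernels centred at `±2θ`
(`born_ampEst_ge`). The two grid points next to the eigenphase carry probability at least `0.57`
(`sum_phaseKernel_ge`), and `sin²` is 1-Lipschitz, so one run has error at most `π/(T+1)` with that
probability. Since `0.57 > 1/2`, an exponential-moment bound makes the failure probability of the
median decay geometrically (`failLE_median`). Decoding multiplies the error by `2B`
(`failLE_estimate`).

With gradient error at most `με/4` and Hessian error at most `με/(6D)`, where `D` is `deltaTilde`,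
one update turns a distance `δ ≤ D` into at most `Mδ²/(2μ) + ε` (`newton_update`,
`newton_error_le`). In the units `u = Mδ/μ`, `η = 2Mε/μ` this is `u ↦ (u² + η)/2`, a mean of `u²`
and `η`. Hence `u` after `n` updates is at most `max(u₀^(2^n), η)`, and `numIter` makes the power at
most `η`, which means `δ ≤ 2ε` (`radius_numIter_le`). The iterates stay in the ball of radius `D`,
where the derivative bounds hold, because `D` lies between the fixed points of the recursion
(`radius_le_deltaTilde`).

A union bound over at most `2 n d²` estimates gives the success probability. A run of amplitude
estimation makes `2T + 1` oracle pairs, and the hypotheses themselves force the required `T` to be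
at least of order one, so rounding up costs only a constant factor. -/

namespace QAENewton

open scoped ENNReal

/-! ### Expectations of randomized computations -/

/-- The expectation of `g` over the result of `q`, run with initial counters `s`. -/
noncomputable def expect {α : Type} (q : Comp α) (g : α → ℝ≥0∞) (s : Calls) : ℝ≥0∞ :=
  ∑' x, q.run s x * g x.1

/-- The expectation of `g` over the result of `q` is at most `b`, whatever the counters. -/
def ExpectLE {α : Type} (q : Comp α) (g : α → ℝ≥0∞) (b : ℝ≥0∞) : Prop :=
  ∀ s, expect q g s ≤ b

theorem pmf_pure_eq {α : Type} (x : α) : (pure x : PMF α) = PMF.pure x := rfl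

theorem pmf_bind_eq {α β : Type} (q : PMF α) (r : α → PMF β) : q >>= r = q.bind r := rfl

section Expectation

variable {α β : Type}

theorem expect_pure (x : α) (g : α → ℝ≥0∞) (s : Calls) : expect (pure x) g s = g x := by
  unfold expect
  rw [StateT.run_pure, pmf_pure_eq, tsum_eq_single (x, s)]
  · simp
  · intro y hy
    simp [PMF.pure_apply, hy]

theorem expect_bind (q : Comp α) (r : α → Comp β) (g : β → ℝ≥0∞) (s : Calls) :
    expect (q >>= r) g s = ∑' x, q.run s x * expect (r x.1) g x.2 := by
  unfold expect
  rw [StateT.run_bind, pmf_bind_eq]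
  simp_rw [PMF.bind_apply, ← ENNReal.tsum_mul_right, ← ENNReal.tsum_mul_left]
  rw [ENNReal.tsum_comm]
  simp_rw [mul_assoc]

theorem ExpectLE.pure {x : α} {g : α → ℝ≥0∞} {b : ℝ≥0∞} (h : g x ≤ b) :
    ExpectLE (Pure.pure x) g b := fun s => (expect_pure x g s).trans_le h

/-- Here `h` bounds the conditional expectation of the remaining computation. Uniformity in the
counters makes the bound usable in whatever state `q` leaves them. -/
theorem ExpectLE.bind {q : Comp α} {r : α → Comp β} {g : β → ℝ≥0∞} {h : α → ℝ≥0∞} {b : ℝ≥0∞}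
    (hq : ExpectLE q h b) (hr : ∀ x, ExpectLE (r x) g (h x)) : ExpectLE (q >>= r) g b := by
  intro s
  rw [expect_bind]
  refine le_trans (ENNReal.tsum_le_tsum fun x => ?_) (hq s)
  gcongr
  exact hr _ _

theorem ExpectLE.mono {q : Comp α} {g g' : α → ℝ≥0∞} {b b' : ℝ≥0∞} (hq : ExpectLE q g b)
    (hg : ∀ x, g' x ≤ g x) (hb : b ≤ b') : ExpectLE q g' b' := by
  intro s
  refine le_trans (ENNReal.tsum_le_tsum fun x => ?_) ((hq s).trans hb)
  gcongr
  exact hg _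

theorem ExpectLE.const_mul {q : Comp α} {g : α → ℝ≥0∞} {b : ℝ≥0∞} (hq : ExpectLE q g b)
    (k : ℝ≥0∞) : ExpectLE q (fun x => k * g x) (k * b) := by
  intro s
  unfold expect
  simp_rw [mul_left_comm _ k, ENNReal.tsum_mul_left]
  gcongr
  exact hq s

theorem ExpectLE.add {q : Comp α} {g g' : α → ℝ≥0∞} {b b' : ℝ≥0∞} (hq : ExpectLE q g b)
    (hq' : ExpectLE q g' b') : ExpectLE q (fun x => g x + g' x) (b + b') := by
  intro s
  unfold expect
  simp_rw [mul_add, ENNReal.tsum_add]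
  exact add_le_add (hq s) (hq' s)

theorem expectLE_const (q : Comp α) (k : ℝ≥0∞) : ExpectLE q (fun _ => k) k := by
  intro s
  unfold expect
  rw [ENNReal.tsum_mul_right, PMF.tsum_coe, one_mul]

/-- Independence in the form needed for exponential moments: each factor is bounded regardless of
the earlier results. -/
theorem expectLE_sampleVec_prod {n : ℕ} (q : Fin n → Comp α) (g : α → ℝ≥0∞) (b : ℝ≥0∞)
    (hq : ∀ i, ExpectLE (q i) g b) :
    ExpectLE (sampleVec q) (fun v => ∏ i, g (v i)) (b ^ n) := by
  induction n with
  | zero => exact ExpectLE.pure (by simp)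
  | succ n ih =>
    refine ExpectLE.bind (h := fun x => b ^ n * g x) ?_ fun x =>
      ExpectLE.bind (h := fun v => g x * ∏ i, g (v i)) ?_ fun v => ExpectLE.pure ?_
    · rw [pow_succ]
      exact (hq 0).const_mul _
    · rw [mul_comm]
      exact (ih _ fun i => hq i.succ).const_mul _
    · rw [Fin.prod_univ_succ]
      simp

theorem expectLE_sampleVec_sum {n : ℕ} (q : Fin n → Comp α) (g : Fin n → α → ℝ≥0∞) (b : ℝ≥0∞)
    (hq : ∀ i, ExpectLE (q i) (g i) b) :
    ExpectLE (sampleVec q) (fun v => ∑ i, g i (v i)) (n * b) := by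
  induction n with
  | zero => exact ExpectLE.pure (by simp)
  | succ n ih =>
    refine ExpectLE.bind (h := fun x => g 0 x + n * b) ?_ fun x =>
      ExpectLE.bind (h := fun v => g 0 x + ∑ i, g i.succ (v i)) ?_ fun v => ExpectLE.pure ?_
    · exact ((hq 0).add (expectLE_const _ _)).mono (fun _ => le_rfl)
        (by rw [Nat.cast_succ, add_mul, one_mul, add_comm])
    · exact (expectLE_const _ _).add (ih _ _ fun i => hq i.succ)
    · rw [Fin.sum_univ_succ]
      simp

end Expectation

/-! ### Probabilities of failure -/

open Classical in
/-- The result of `q` lies outside `G` with probability at most `b`. -/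
def FailLE {α : Type} (q : Comp α) (G : α → Prop) (b : ℝ≥0∞) : Prop :=
  ExpectLE q (fun x => if G x then 0 else 1) b

section Failure

variable {α β : Type}

theorem FailLE.pure {x : α} {G : α → Prop} (h : G x) : FailLE (Pure.pure x) G 0 :=
  ExpectLE.pure (by simp [h])

theorem failLE_one (q : Comp α) (G : α → Prop) : FailLE q G 1 :=
  (expectLE_const q 1).mono (fun x => by split_ifs <;> simp) le_rfl

/-- Union bound: the second computation is judged only where the first succeeds; elsewhere its
failure probability is bounded by 1. -/
theorem FailLE.bind {q : Comp α} {r : α → Comp β} {G : α → Prop} {G' : β → Prop} {b b' : ℝ≥0∞}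
    (hq : FailLE q G b) (hr : ∀ x, G x → FailLE (r x) G' b') : FailLE (q >>= r) G' (b + b') := by
  classical
  refine ExpectLE.bind (h := fun x => (if G x then 0 else 1) + b')
    (ExpectLE.add hq (expectLE_const _ _)) fun x => ?_
  by_cases h : G x
  · simp only [h, if_true, zero_add]
    exact hr x h
  · exact (failLE_one (r x) G').mono (fun _ => le_rfl) (by simp [h])

theorem FailLE.bind_pure {q : Comp α} {r : α → β} {G : α → Prop} {G' : β → Prop} {b : ℝ≥0∞}
    (hq : FailLE q G b) (hr : ∀ x, G x → G' (r x)) :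
    FailLE (q >>= fun x => Pure.pure (r x)) G' b := by
  simpa using FailLE.bind hq (b' := 0) fun x hx => FailLE.pure (hr x hx)

theorem failLE_sampleVec {n : ℕ} {q : Fin n → Comp α} {G : Fin n → α → Prop} {b : ℝ≥0∞}
    (hq : ∀ i, FailLE (q i) (G i) b) :
    FailLE (sampleVec q) (fun v => ∀ i, G i (v i)) (n * b) := by
  classical
  refine (expectLE_sampleVec_sum q (fun i x => if G i x then 0 else 1) b hq).mono
    (fun v => ?_) le_rfl
  split_ifs with h
  · simp
  · push Not at h
    obtain ⟨i, hi⟩ := h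
    refine le_trans ?_ (Finset.single_le_sum (fun _ _ => zero_le) (Finset.mem_univ i))
    simp [hi]

end Failure

/-! ### The median of independent estimates -/

/-- A median outside the interval drags along the `s + 1` entries on its side of the sorted list,
one more than the allowed number of bad entries. -/
theorem median_mem_of_card {s : ℕ} (v : Fin (2 * s + 1) → ℝ) (l u : ℝ)
    (h : (Finset.univ.filter fun i => ¬ (l ≤ v i ∧ v i ≤ u)).card ≤ s) :
    l ≤ median v ∧ median v ≤ u := by
  classical
  have hmono := Tuple.monotone_sort v
  have hinj := (Tuple.sort v).injective
  set m : Fin (2 * s + 1) := ⟨s, by omega⟩ with hm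
  constructor
  · by_contra hlt
    push Not at hlt
    have hsub : (Finset.Iic m).image (Tuple.sort v) ⊆
        Finset.univ.filter fun i => ¬ (l ≤ v i ∧ v i ≤ u) := by
      intro i hi
      obtain ⟨j, hj, rfl⟩ := Finset.mem_image.1 hi
      have : v (Tuple.sort v j) ≤ v (Tuple.sort v m) := hmono (Finset.mem_Iic.1 hj)
      have : v (Tuple.sort v j) < l := this.trans_lt hlt
      exact Finset.mem_filter.2 ⟨Finset.mem_univ _, fun hh => absurd hh.1 (not_le.2 this)⟩
    have := Finset.card_le_card hsub
    rw [Finset.card_image_of_injective _ hinj, Fin.card_Iic] at this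
    have hm' : (m : ℕ) = s := rfl
    omega
  · by_contra hlt
    push Not at hlt
    have hsub : (Finset.Ici m).image (Tuple.sort v) ⊆
        Finset.univ.filter fun i => ¬ (l ≤ v i ∧ v i ≤ u) := by
      intro i hi
      obtain ⟨j, hj, rfl⟩ := Finset.mem_image.1 hi
      have : v (Tuple.sort v m) ≤ v (Tuple.sort v j) := hmono (Finset.mem_Ici.1 hj)
      have : u < v (Tuple.sort v j) := hlt.trans_le this
      exact Finset.mem_filter.2 ⟨Finset.mem_univ _, fun hh => absurd hh.2 (not_le.2 this)⟩
    have := Finset.card_le_card hsub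
    rw [Finset.card_image_of_injective _ hinj, Fin.card_Ici] at this
    have hm' : (m : ℕ) = s := rfl
    omega

/-- The median of `2s + 1` estimates, each wrong with probability at most `43/100`. -/
theorem failLE_median {s : ℕ} (q : Fin (2 * s + 1) → Comp ℝ) (l u : ℝ)
    (hq : ∀ i, FailLE (q i) (fun x => l ≤ x ∧ x ≤ u) (ENNReal.ofReal (43 / 100))) :
    FailLE (sampleVec q) (fun v => l ≤ median v ∧ median v ≤ u)
      (ENNReal.ofReal ((981 / 1000) ^ s)) := by
  classical
  -- Chernoff's method with weight `4/3` for a wrong estimate: the mean weight is at most `1 +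
  -- 0.43/3 = 343/300`.
  have h1 : ∀ i, ExpectLE (q i)
      (fun x => if l ≤ x ∧ x ≤ u then 1 else ENNReal.ofReal (4 / 3))
      (ENNReal.ofReal (343 / 300)) := by
    intro i
    refine ((expectLE_const (q i) 1).add ((hq i).const_mul (ENNReal.ofReal (1 / 3)))).mono
      (fun x => ?_) ?_
    · split_ifs with h
      · simp
      · rw [mul_one, ← ENNReal.ofReal_one, ← ENNReal.ofReal_add (by norm_num) (by norm_num)]
        exact ENNReal.ofReal_le_ofReal (by norm_num)
    · rw [← ENNReal.ofReal_mul (by norm_num), ← ENNReal.ofReal_one,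
        ← ENNReal.ofReal_add (by norm_num) (by norm_num)]
      exact ENNReal.ofReal_le_ofReal (by norm_num)
  -- A bad median needs `s + 1` wrong estimates, hence a product of weights at least `(4/3)^(s+1)`.
  -- The decay rate is `3/4 · (343/300)² < 0.981`.
  refine ((expectLE_sampleVec_prod q _ _ h1).const_mul
    (ENNReal.ofReal ((3 / 4) ^ (s + 1)))).mono (fun v => ?_) ?_
  · split_ifs with h
    · simp
    · have hc : s + 1 ≤ (Finset.univ.filter fun i => ¬ (l ≤ v i ∧ v i ≤ u)).card := by
        by_contra hc
        exact h (median_mem_of_card v l u (by omega))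
      rw [Finset.prod_ite, Finset.prod_const_one, one_mul, Finset.prod_const,
        ← ENNReal.ofReal_pow (by norm_num), ← ENNReal.ofReal_mul (by positivity),
        ← ENNReal.ofReal_one]
      refine ENNReal.ofReal_le_ofReal ?_
      calc (1 : ℝ) = (3 / 4) ^ (s + 1) * (4 / 3) ^ (s + 1) := by
            rw [← mul_pow]; norm_num
        _ ≤ _ := by gcongr; norm_num
  · rw [← ENNReal.ofReal_pow (by norm_num), ← ENNReal.ofReal_mul (by positivity)]
    refine ENNReal.ofReal_le_ofReal ?_
    have : (3 / 4 : ℝ) ^ (s + 1) * (343 / 300) ^ (2 * s + 1) =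
        (3 / 4 * (343 / 300)) * (3 / 4 * (343 / 300) ^ 2) ^ s := by
      rw [mul_pow, ← pow_mul]; ring
    rw [this]
    calc (3 / 4 * (343 / 300) : ℝ) * (3 / 4 * (343 / 300) ^ 2) ^ s
        ≤ 1 * (981 / 1000) ^ s := by gcongr <;> norm_num
      _ = _ := one_mul _

/-! ### Oracle calls -/

/-- Every run of `q` makes exactly `k` oracle calls. -/
def Costs {α : Type} (q : Comp α) (k : Calls) : Prop :=
  ∀ s, ∀ x ∈ (q.run s).support, x.2 = s + k

section Cost

variable {α β : Type}

theorem mem_support_run_bind {q : Comp α} {r : α → Comp β} {s : Calls} {x : β × Calls} :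
    x ∈ ((q >>= r).run s).support ↔
      ∃ y ∈ (q.run s).support, x ∈ ((r y.1).run y.2).support := by
  rw [StateT.run_bind, pmf_bind_eq, PMF.mem_support_bind_iff]

theorem mem_support_run_pure {y : α} {s : Calls} {x : α × Calls} :
    x ∈ ((pure y : Comp α).run s).support ↔ x = (y, s) := by
  rw [StateT.run_pure, pmf_pure_eq, PMF.mem_support_pure_iff]

theorem Costs.pure (x : α) : Costs (Pure.pure x) 0 := by
  intro s y hy
  rw [mem_support_run_pure] at hy
  simp [hy]

theorem Costs.bind {q : Comp α} {r : α → Comp β} {k k' : Calls} (hq : Costs q k)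
    (hr : ∀ x, Costs (r x) k') : Costs (q >>= r) (k + k') := by
  intro s x hx
  obtain ⟨y, hy, hxy⟩ := mem_support_run_bind.1 hx
  rw [hr _ _ _ hxy, hq _ _ hy, add_assoc]

theorem Costs.bind_pure {q : Comp α} {r : α → β} {k : Calls} (hq : Costs q k) :
    Costs (q >>= fun x => Pure.pure (r x)) k :=
  hq.bind (k' := 0) fun x => Costs.pure (r x)

theorem costs_sampleVec {n : ℕ} {q : Fin n → Comp α} {k : Calls} (hq : ∀ i, Costs (q i) k) :
    Costs (sampleVec q) (n • k) := by
  induction n with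
  | zero => rw [zero_nsmul]; exact Costs.pure _
  | succ n ih =>
    rw [succ_nsmul']
    exact (hq 0).bind fun x => (ih fun i => hq i.succ).bind_pure

theorem costs_modify (k : Calls) : Costs (modify (· + k) : Comp PUnit) k := by
  intro s x hx
  have : (modify (· + k) : Comp PUnit).run s = PMF.pure (PUnit.unit, s + k) := rfl
  rw [this, PMF.mem_support_pure_iff] at hx
  rw [hx]

theorem costs_lift (m : PMF α) : Costs (StateT.lift m : Comp α) 0 := by
  intro s x hx
  have : (StateT.lift m : Comp α).run s = m.bind fun a => PMF.pure (a, s) := rfl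
  rw [this, PMF.mem_support_bind_iff] at hx
  obtain ⟨a, -, ha⟩ := hx
  rw [PMF.mem_support_pure_iff] at ha
  simp [ha]

end Cost

/-! ### Coefficients and states of the circuits -/

/-- The states with phase `j` and point `a`. -/
noncomputable def sector {d p N T : ℕ} (j : Fin (T + 1)) (a : Pt d) :
    Submodule ℂ (State d p N T) :=
  Finsupp.supported ℂ ℂ {e | e.phase = j ∧ e.pt = a}

theorem ket_mem_sector {d p N T : ℕ} {j : Fin (T + 1)} {a : Pt d} {e : Label d p N T}
    (hj : e.phase = j) (ha : e.pt = a) : ket e ∈ sector j a :=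
  Finsupp.single_mem_supported ℂ 1 ⟨hj, ha⟩

theorem conj_fourierCoeff (n : ℕ) (inv : Bool) (x y : Fin n) :
    starRingEnd ℂ (fourierCoeff n inv x y) = fourierCoeff n (!inv) x y := by
  unfold fourierCoeff
  rw [map_mul, Complex.conj_ofReal, ← Complex.exp_conj]
  congr 2
  have h2 : starRingEnd ℂ 2 = 2 := Complex.conj_ofNat 2
  cases inv <;> simp [h2, neg_div]

theorem fourierCoeff_comm (n : ℕ) (inv : Bool) (x y : Fin n) :
    fourierCoeff n inv x y = fourierCoeff n inv y x := by
  unfold fourierCoeff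
  congr 3
  ring

theorem fourierCoeff_zero (n : ℕ) [NeZero n] (inv : Bool) (y : Fin n) :
    fourierCoeff n inv 0 y = (1 / √n : ℝ) := by
  simp [fourierCoeff]

theorem encode_nonneg (B v : ℝ) : 0 ≤ encode B v := le_max_left _ _

theorem encode_le_one (B v : ℝ) : encode B v ≤ 1 := max_le zero_le_one (min_le_left _ _)

theorem sum_rotCoeff_mul_rotCoeff (B v : ℝ) (x y : Bool) :
    ∑ z, (rotCoeff (encode B v) true x z : ℂ) * (rotCoeff (encode B v) false z y : ℂ) =
      if x = y then 1 else 0 := by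
  have h0 := Real.mul_self_sqrt (encode_nonneg B v)
  have h1 := Real.mul_self_sqrt (sub_nonneg.2 (encode_le_one B v))
  simp only [← Complex.ofReal_mul, ← Complex.ofReal_sum, Fintype.sum_bool]
  cases x <;> cases y <;> simp [rotCoeff] <;> norm_cast <;> linarith

section Branches

variable {d p N T : ℕ} (f : Pt d → Par p → ℝ) (c : Fin N → Par p) (B : ℝ)

/-- The probability that encodes the derivative `t` at `(a, c_k)`. -/
noncomputable def encoded (t : Target d) (a : Pt d) (k : Fin N) : ℝ :=
  encode B (partialDeriv f t a (c k))

/-- The probability of the flag `1` in the state `A|0⟩`. -/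
noncomputable def flagProb (t : Target d) (a : Pt d) : ℝ := 1 / N * ∑ k, encoded f c B t a k

/-- Basis states of `A|0⟩`. -/
noncomputable def branchLabel (t : Target d) (a : Pt d) (y : Bool) (j : Fin (T + 1)) (k : Fin N) :
    Label d p N T :=
  ⟨j, a, k, c k, partialDeriv f t a (c k), y⟩

noncomputable def branchCoeff (t : Target d) (a : Pt d) (y : Bool) (k : Fin N) : ℝ :=
  1 / √N * rotCoeff (encoded f c B t a k) false false y

/-- The part of `A|0⟩` with flag `y`. -/
noncomputable def branch (t : Target d) (a : Pt d) (y : Bool) (j : Fin (T + 1)) : State d p N T :=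
  ∑ k, (branchCoeff f c B t a y k : ℂ) • ket (branchLabel f c t a y j k)

theorem branch_mem_sector (t : Target d) (a : Pt d) (y : Bool) (j : Fin (T + 1)) :
    branch f c B t a y j ∈ sector j a :=
  Submodule.sum_mem _ fun _ _ => Submodule.smul_mem _ _ (ket_mem_sector rfl rfl)

theorem branchLabel_inj {t : Target d} {a : Pt d} {y y' : Bool} {j j' : Fin (T + 1)}
    {k k' : Fin N} :
    branchLabel (T := T) f c t a y j k = branchLabel f c t a y' j' k' ↔
      y = y' ∧ j = j' ∧ k = k' := by
  constructor
  · intro h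
    simp only [branchLabel, Label.mk.injEq] at h
    tauto
  · rintro ⟨rfl, rfl, rfl⟩
    rfl

theorem branch_apply (t : Target d) (a : Pt d) (y y' : Bool) (l l' : Fin (T + 1)) (k : Fin N) :
    branch f c B t a y l (branchLabel f c t a y' l' k) =
      if y = y' ∧ l = l' then (branchCoeff f c B t a y k : ℂ) else 0 := by
  classical
  simp only [branch, Finsupp.finsetSum_apply, Finsupp.smul_apply, Finsupp.single_apply,
    branchLabel_inj]
  split_ifs with h
  · simp [h]
  · simp only [smul_eq_mul, mul_ite, mul_one, mul_zero]
    exact Finset.sum_eq_zero fun k' _ => if_neg (by tauto)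

theorem flagProb_nonneg (t : Target d) (a : Pt d) : 0 ≤ flagProb f c B t a :=
  mul_nonneg (by positivity) (Finset.sum_nonneg fun _ _ => encode_nonneg _ _)

end Branches

/-! ### Linearity and inverses of circuits -/

section Circuits

variable {d p N T : ℕ} [NeZero N] (f : Pt d → Par p → ℝ) (c : Fin N → Par p) (B : ℝ)

/-- The linear map executed by a circuit. -/
noncomputable def circuitMap (C : List (Gate d)) : State d p N T →ₗ[ℂ] State d p N T where
  toFun := runCircuit f c B C
  map_add' ψ φ := by
    induction C generalizing ψ φ with
    | nil => rfl
    | cons g C ih => simp only [runCircuit, map_add, ih]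
  map_smul' z ψ := by
    induction C generalizing ψ with
    | nil => rfl
    | cons g C ih => simp only [runCircuit, map_smul, ih, RingHom.id_apply]

theorem circuitMap_nil (ψ : State d p N T) : circuitMap f c B [] ψ = ψ := rfl

theorem circuitMap_cons (g : Gate d) (C : List (Gate d)) (ψ : State d p N T) :
    circuitMap f c B (g :: C) ψ = circuitMap f c B C (g.apply f c B ψ) := rfl

theorem circuitMap_append (C C' : List (Gate d)) (ψ : State d p N T) :
    circuitMap f c B (C ++ C') ψ = circuitMap f c B C' (circuitMap f c B C ψ) := by
  induction C generalizing ψ with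
  | nil => rfl
  | cons g C ih => rw [List.cons_append, circuitMap_cons, circuitMap_cons, ih]

theorem Gate.apply_ket (g : Gate d) (e : Label d p N T) :
    g.apply f c B (ket e) = g.onKet f c B e := by
  simp [Gate.apply]

theorem dot_circuitMap (C : List (Gate d)) (φ ψ : State d p N T) :
    dot (circuitMap f c B C φ) (circuitMap f c B C ψ) = dot φ ψ := by
  induction C generalizing φ ψ with
  | nil => rfl
  | cons g C ih =>
    rw [circuitMap_cons, circuitMap_cons, ih]
    exact dot_linearCombination _ (g.onKet_orthonormal f c B) φ ψ

theorem Gate.apply_apply_of_ket {g g' : Gate d}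
    (h : ∀ e : Label d p N T, g'.apply f c B (g.onKet f c B e) = ket e) (ψ : State d p N T) :
    g'.apply f c B (g.apply f c B ψ) = ψ := by
  have : (g'.apply f c B).comp (g.apply f c B) = LinearMap.id (M := State d p N T) := by
    refine Finsupp.lhom_ext' fun e => LinearMap.ext_ring ?_
    simpa [Gate.apply_ket] using h e
  exact LinearMap.congr_fun this ψ

theorem fourierIdx_inverse (ψ : State d p N T) :
    (Gate.fourierIdx false).apply f c B ((Gate.fourierIdx true).apply f c B ψ) = ψ := by
  refine Gate.apply_apply_of_ket f c B (fun e => ?_) ψ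
  simp only [Gate.onKet, map_sum, map_smul, Gate.apply_ket, Finset.smul_sum, smul_smul]
  rw [Finset.sum_comm]
  have key : ∀ y, ∑ k, fourierCoeff N true e.idx k * fourierCoeff N false k y =
      if e.idx = y then 1 else 0 := by
    intro y
    rw [← fourierCoeff_orthonormal N false e.idx y]
    refine Finset.sum_congr rfl fun k _ => ?_
    rw [conj_fourierCoeff, fourierCoeff_comm N false k y]
    rfl
  simp_rw [← Finset.sum_smul, key]
  simp

theorem queryPar_inverse (ψ : State d p N T) :
    (Gate.queryPar false).apply f c B ((Gate.queryPar true).apply f c B ψ) = ψ := by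
  refine Gate.apply_apply_of_ket f c B (fun e => ?_) ψ
  simp [Gate.onKet, Gate.apply_ket]

theorem queryDeriv_inverse (t : Target d) (ψ : State d p N T) :
    (Gate.queryDeriv t false).apply f c B ((Gate.queryDeriv t true).apply f c B ψ) = ψ := by
  refine Gate.apply_apply_of_ket f c B (fun e => ?_) ψ
  simp [Gate.onKet, Gate.apply_ket]

theorem rotate_inverse (ψ : State d p N T) :
    (Gate.rotate false).apply f c B ((Gate.rotate true).apply f c B ψ) = ψ := by
  refine Gate.apply_apply_of_ket f c B (fun e => ?_) ψ
  rw [Gate.onKet, map_sum]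
  simp_rw [map_smul, Gate.apply_ket, Gate.onKet, Finset.smul_sum, smul_smul]
  rw [Finset.sum_comm]
  simp_rw [← Finset.sum_smul, sum_rotCoeff_mul_rotCoeff]
  simp

/-- Gatewise cancellation. This order of composition is the one inside `grover`, where `A⁻¹` acts
before `A`. -/
theorem prepare_unprepare (t : Target d) (ψ : State d p N T) :
    circuitMap f c B (prepare t) (circuitMap f c B (unprepare t) ψ) = ψ := by
  rw [prepare, unprepare, circuitMap_cons, circuitMap_cons, circuitMap_cons, circuitMap_cons,
    circuitMap_nil, circuitMap_cons, circuitMap_cons, circuitMap_cons, circuitMap_cons,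
    circuitMap_nil, fourierIdx_inverse, queryPar_inverse, queryDeriv_inverse, rotate_inverse]

/-! ### The Grover operator -/

theorem Gate.apply_mem_sector {j : Fin (T + 1)} {a : Pt d} {g : Gate d}
    (h : ∀ e : Label d p N T, e.phase = j → e.pt = a → g.onKet f c B e ∈ sector j a)
    {ψ : State d p N T} (hψ : ψ ∈ sector j a) : g.apply f c B ψ ∈ sector j a := by
  rw [Gate.apply, Finsupp.linearCombination_apply]
  refine Submodule.sum_mem _ fun e he => Submodule.smul_mem _ _ ?_
  have := (Finsupp.mem_supported ℂ ψ).1 hψ he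
  exact h e this.1 this.2

theorem unprepare_mem_sector {j : Fin (T + 1)} {a : Pt d} (t : Target d) {ψ : State d p N T}
    (hψ : ψ ∈ sector j a) : circuitMap f c B (unprepare t) ψ ∈ sector j a := by
  simp only [unprepare, circuitMap_cons, circuitMap_nil]
  refine Gate.apply_mem_sector f c B (fun e hj ha => ?_) (Gate.apply_mem_sector f c B
    (fun e hj ha => ?_) (Gate.apply_mem_sector f c B (fun e hj ha => ?_)
    (Gate.apply_mem_sector f c B (fun e hj ha => ?_) hψ)))
  · exact Submodule.sum_mem _ fun k _ => Submodule.smul_mem _ _ (ket_mem_sector hj ha)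
  · exact ket_mem_sector hj ha
  · exact ket_mem_sector hj ha
  · exact Submodule.sum_mem _ fun k _ => Submodule.smul_mem _ _ (ket_mem_sector hj ha)

/-- With phase and point fixed, only one label escapes the sign change, so the gate is `2|0⟩⟨0| -
1`. This is `-S₀`: the minus sign of `Q` is contained in it. -/
theorem signNonzero_apply {j : Fin (T + 1)} {a : Pt d} {n : ℕ} {ψ : State d p N T}
    (hψ : ψ ∈ sector j a) :
    (Gate.signNonzero n).apply f c B ψ =
      if n < (j : ℕ) then
        (2 * dot (ket ⟨j, a, 0, 0, 0, false⟩) ψ) • ket ⟨j, a, 0, 0, 0, false⟩ - ψ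
      else ψ := by
  classical
  have h : ∀ e ∈ ψ.support, (Gate.signNonzero n).onKet f c B e =
      if n < (j : ℕ) then
        (2 * dot (ket ⟨j, a, 0, 0, 0, false⟩) (ket e)) • ket ⟨j, a, 0, 0, 0, false⟩ - ket e
      else ket e := by
    rintro ⟨j', a', k, q, v, y⟩ he
    obtain ⟨rfl, rfl⟩ := (Finsupp.mem_supported ℂ ψ).1 hψ he
    rw [Gate.onKet, dot_single]
    by_cases hn : n < (j' : ℕ)
    · by_cases h0 : k = 0 ∧ q = 0 ∧ v = 0 ∧ y = false
      · obtain ⟨rfl, rfl, rfl, rfl⟩ := h0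
        simp [hn, two_smul]
      · have h0' : ¬ ((⟨j', a', 0, 0, 0, false⟩ : Label d p N T) = ⟨j', a', k, q, v, y⟩) := by
          rintro ⟨⟩
          simp at h0
        simp only [hn, h0, h0', true_and, not_false_iff, if_true, if_false]
        simp
    · simp [hn]
  conv_rhs => rw [← Finsupp.sum_single ψ]
  rw [Gate.apply, Finsupp.linearCombination_apply, Finsupp.sum, Finsupp.sum, dot_sum_right]
  rw [Finset.sum_congr rfl fun e he => by rw [h e he]]
  split_ifs with hn
  · rw [Finset.mul_sum, Finset.sum_smul, ← Finset.sum_sub_distrib]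
    refine Finset.sum_congr rfl fun e _ => ?_
    rw [← Finsupp.smul_single_one e, dot_smul_right, smul_sub, smul_smul]
    congr 2
    ring
  · refine Finset.sum_congr rfl fun e _ => ?_
    rw [Finsupp.smul_single_one]

/-- The state `A|0⟩` on the sector with phase `j` and point `a`. -/
noncomputable def prepared (t : Target d) (j : Fin (T + 1)) (a : Pt d) : State d p N T :=
  circuitMap f c B (prepare t) (ket ⟨j, a, 0, 0, 0, false⟩)

/-- Conjugation by `A` moves the reflection from `|0⟩` to `A|0⟩`; the inner product is carried along
because circuits are isometries. When the control is off, `A⁻¹` and `A` cancel. -/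
theorem grover_apply (t : Target d) {j : Fin (T + 1)} {a : Pt d} {n : ℕ} {ψ φ : State d p N T}
    (hφ : (Gate.signFlag n).apply f c B ψ = φ) (h : φ ∈ sector j a) :
    circuitMap f c B (grover t n) ψ =
      if n < (j : ℕ) then
        (2 * dot (prepared f c B t j a) φ) • prepared f c B t j a - φ
      else φ := by
  rw [grover, circuitMap_append, circuitMap_append, circuitMap_append, circuitMap_cons,
    circuitMap_nil, circuitMap_cons, circuitMap_nil, hφ,
    signNonzero_apply f c B (unprepare_mem_sector f c B t h)]
  split_ifs with hn
  · rw [map_sub, map_smul, prepare_unprepare,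
      ← dot_circuitMap f c B (prepare t) _ (circuitMap f c B (unprepare t) φ), prepare_unprepare]
    rfl
  · exact prepare_unprepare f c B t φ

/-! ### The states in the circuit of amplitude estimation -/

theorem prepared_eq (t : Target d) (j : Fin (T + 1)) (a : Pt d) :
    prepared f c B t j a = branch f c B t a false j + branch f c B t a true j := by
  rw [prepared, prepare, circuitMap_cons, circuitMap_cons, circuitMap_cons, circuitMap_cons,
    circuitMap_nil, Gate.apply_ket, Gate.onKet, branch, branch, ← Finset.sum_add_distrib]
  simp_rw [map_sum, map_smul, Gate.apply_ket, Gate.onKet, Gate.apply_ket, Gate.onKet,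
    Gate.apply_ket, Gate.onKet, fourierCoeff_zero]
  refine Finset.sum_congr rfl fun k _ => ?_
  rw [Fintype.sum_bool, smul_add, smul_smul, smul_smul, add_comm]
  simp [branchCoeff, branchLabel, encoded]

theorem sum_branchCoeff_sq (t : Target d) (a : Pt d) (y : Bool) :
    ∑ k, branchCoeff f c B t a y k ^ 2 =
      if y then flagProb f c B t a else 1 - flagProb f c B t a := by
  have hN : (0 : ℝ) < N := by exact_mod_cast NeZero.pos N
  cases y
  · have : ∀ k, branchCoeff f c B t a false k ^ 2 = 1 / N * (1 - encoded f c B t a k) := by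
      intro k
      rw [branchCoeff, mul_pow, div_pow, Real.sq_sqrt hN.le, rotCoeff, if_pos rfl,
        encoded, Real.sq_sqrt (sub_nonneg.2 (encode_le_one B (partialDeriv f t a (c k)))), one_pow]
    simp [this, ← Finset.mul_sum, flagProb, mul_sub, hN.ne']
  · have : ∀ k, branchCoeff f c B t a true k ^ 2 = 1 / N * encoded f c B t a k := by
      intro k
      rw [branchCoeff, mul_pow, div_pow, Real.sq_sqrt hN.le, rotCoeff, if_neg (by simp),
        if_pos rfl, encoded, Real.sq_sqrt (encode_nonneg _ _), one_pow]
    simp [this, ← Finset.mul_sum, flagProb]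

theorem dot_branch (t : Target d) (a : Pt d) (y y' : Bool) (j : Fin (T + 1)) :
    dot (branch f c B t a y j) (branch f c B t a y' j) =
      if y = y' then ((if y then flagProb f c B t a else 1 - flagProb f c B t a : ℝ) : ℂ)
        else 0 := by
  classical
  rw [branch, branch, dot_sum_left, ← sum_branchCoeff_sq f c B t a y]
  simp_rw [dot_sum_right, dot_smul_left, dot_smul_right, dot_single, branchLabel_inj]
  split_ifs with h
  · subst h
    simp [sq]
  · simp [h]

theorem signFlag_branch (t : Target d) (a : Pt d) (y : Bool) (j : Fin (T + 1)) (n : ℕ) :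
    (Gate.signFlag n).apply f c B (branch f c B t a y j) =
      (if n < (j : ℕ) ∧ y = true then -1 else 1 : ℂ) • branch f c B t a y j := by
  rw [branch, map_sum, Finset.smul_sum]
  refine Finset.sum_congr rfl fun k _ => ?_
  rw [map_smul, Gate.apply_ket, Gate.onKet, smul_comm]
  rfl

/-- The coefficients of `Q^n A|0⟩` with respect to the two parts of `A|0⟩`, when the flag is `1`
with probability `q` in `A|0⟩`. -/
noncomputable def groverCoeff (q : ℝ) : ℕ → ℝ × ℝ
  | 0 => (1, 1)
  | n + 1 =>
    (2 * ((groverCoeff q n).1 * (1 - q) - (groverCoeff q n).2 * q) - (groverCoeff q n).1,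
      2 * ((groverCoeff q n).1 * (1 - q) - (groverCoeff q n).2 * q) + (groverCoeff q n).2)

/-- The state `Q^n A|0⟩` on the sector with phase `j`. -/
noncomputable def rotated (t : Target d) (a : Pt d) (n : ℕ) (j : Fin (T + 1)) : State d p N T :=
  ((groverCoeff (flagProb f c B t a) n).1 : ℂ) • branch f c B t a false j +
    ((groverCoeff (flagProb f c B t a) n).2 : ℂ) • branch f c B t a true j

/-- The copy with index `n` is active exactly for `j > n`, so `min j n` counts the effective uses of
`Q` after `n` copies. The flag sign flips the second coefficient, and reflection about `A|0⟩` gives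
the recursion of `groverCoeff`. -/
theorem grover_rotated (t : Target d) (a : Pt d) (n : ℕ) (j : Fin (T + 1)) :
    circuitMap f c B (grover t n) (rotated f c B t a (min (j : ℕ) n) j) =
      rotated f c B t a (min (j : ℕ) (n + 1)) j := by
  by_cases hn : n < (j : ℕ)
  · rw [min_eq_right hn.le, min_eq_right hn]
    rw [grover_apply f c B t (j := j) (a := a)
      (φ := ((groverCoeff (flagProb f c B t a) n).1 : ℂ) • branch f c B t a false j +
        (-(groverCoeff (flagProb f c B t a) n).2 : ℂ) • branch f c B t a true j), if_pos hn,
      prepared_eq]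
    · simp only [dot_add_left, dot_add_right, dot_smul_right, dot_branch, rotated, groverCoeff]
      simp only [Complex.ofReal_add, Complex.ofReal_sub, Complex.ofReal_mul]
      simp
      module
    · rw [rotated, map_add, map_smul, map_smul, signFlag_branch, signFlag_branch]
      simp [hn]
    · exact Submodule.add_mem _ (Submodule.smul_mem _ _ (branch_mem_sector ..))
        (Submodule.smul_mem _ _ (branch_mem_sector ..))
  · have hn' : (j : ℕ) ≤ n := not_lt.1 hn
    rw [min_eq_left hn', min_eq_left (hn'.trans n.le_succ)]
    rw [grover_apply f c B t (j := j) (a := a) (φ := rotated f c B t a j j), if_neg hn]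
    · rw [rotated, map_add, map_smul, map_smul, signFlag_branch, signFlag_branch]
      simp [hn]
    · exact Submodule.add_mem _ (Submodule.smul_mem _ _ (branch_mem_sector ..))
        (Submodule.smul_mem _ _ (branch_mem_sector ..))

theorem iterate_grover_rotated (t : Target d) (a : Pt d) (n : ℕ) (j : Fin (T + 1)) :
    circuitMap f c B ((List.range n).flatMap (grover t)) (rotated f c B t a 0 j) =
      rotated f c B t a (min (j : ℕ) n) j := by
  induction n with
  | zero => simp [circuitMap_nil]
  | succ n ih =>
    rw [List.range_succ, List.flatMap_append, circuitMap_append, ih, List.flatMap_singleton,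
      grover_rotated]

theorem fourierPhase_branch (t : Target d) (a : Pt d) (y : Bool) (j : Fin (T + 1)) (inv : Bool) :
    (Gate.fourierPhase inv).apply f c B (branch f c B t a y j) =
      ∑ l, fourierCoeff (T + 1) inv j l • branch f c B t a y l := by
  simp_rw [branch, map_sum, map_smul, Gate.apply_ket, Gate.onKet, Finset.smul_sum]
  rw [Finset.sum_comm]
  refine Finset.sum_congr rfl fun l _ => Finset.sum_congr rfl fun k _ => ?_
  rw [smul_comm]
  rfl

/-- The final state of amplitude estimation. -/
theorem circuitMap_ampEst (t : Target d) (a : Pt d) :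
    circuitMap f c B (ampEst t T) (ket (initLabel a) : State d p N T) =
      ∑ l : Fin (T + 1), ∑ j : Fin (T + 1),
        (((1 / √(T + 1 : ℕ) : ℝ) : ℂ) * fourierCoeff (T + 1) true j l) •
          rotated f c B t a j l := by
  rw [ampEst, circuitMap_append, circuitMap_append, circuitMap_append,
    circuitMap_cons f c B (Gate.fourierPhase false), circuitMap_nil, Gate.apply_ket, Gate.onKet,
    map_sum, map_sum, circuitMap_cons, circuitMap_nil, map_sum, Finset.sum_comm]
  refine Finset.sum_congr rfl fun j _ => ?_
  have h : circuitMap f c B (prepare t) (ket ⟨j, a, 0, 0, 0, false⟩ : State d p N T) =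
      rotated f c B t a 0 j := by
    rw [← prepared, prepared_eq, rotated]
    simp [groverCoeff]
  simp only [initLabel, map_smul, h, iterate_grover_rotated, fourierCoeff_zero]
  -- As `j ≤ T`, the `T` controlled copies amount to exactly `j` uses of `Q`.
  rw [min_eq_left (Nat.lt_succ_iff.1 j.isLt), rotated, map_add, map_smul, map_smul,
    fourierPhase_branch, fourierPhase_branch]
  simp_rw [rotated, mul_smul, smul_add, Finset.smul_sum, ← Finset.sum_add_distrib]
  refine Finset.sum_congr rfl fun l _ => ?_
  module

end Circuits

/-! ### The kernel of phase estimation -/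

/-- The probability that phase estimation on `M` points has an outcome that differs by the
angle `φ` from the eigenphase. -/
noncomputable def phaseKernel (M : ℕ) (φ : ℝ) : ℝ :=
  ‖(1 / M : ℂ) * ∑ j ∈ Finset.range M, Complex.exp (Complex.I * φ) ^ j‖ ^ 2

theorem phaseKernel_nonneg (M : ℕ) (φ : ℝ) : 0 ≤ phaseKernel M φ := by
  unfold phaseKernel; positivity

theorem phaseKernel_add_int_mul_two_pi (M : ℕ) (φ : ℝ) (m : ℤ) :
    phaseKernel M (φ + m * (2 * π)) = phaseKernel M φ := by
  unfold phaseKernel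
  congr 5
  ext j
  congr 1
  rw [Complex.exp_eq_exp_iff_exists_int]
  exact ⟨m, by push_cast; ring⟩

theorem phaseKernel_zero {M : ℕ} (hM : 0 < M) : phaseKernel M 0 = 1 := by
  have : (M : ℂ) ≠ 0 := by exact_mod_cast hM.ne'
  simp [phaseKernel, this]

/-- For the geometric sum with ratio `w`, the numerator `|w^M - 1|` is exactly `2|sin πx|`, while
the denominator `|w - 1|` is at most `2π|x|/M`. -/
theorem le_phaseKernel {M : ℕ} (hM : 0 < M) {x : ℝ} (hx : x ≠ 0) :
    sin (π * x) ^ 2 / (π * x) ^ 2 ≤ phaseKernel M (2 * π * x / M) := by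
  have hM' : (0 : ℝ) < M := by exact_mod_cast hM
  set w := Complex.exp (Complex.I * (2 * π * x / M : ℝ)) with hw
  have h1 : ‖w - 1‖ ≤ 2 * |π * x| / M := by
    rw [hw, Complex.norm_exp_I_mul_ofReal_sub_one, norm_mul, Real.norm_ofNat, Real.norm_eq_abs]
    have : |sin (2 * π * x / M / 2)| ≤ |2 * π * x / M / 2| := Real.abs_sin_le_abs
    calc 2 * |sin (2 * π * x / M / 2)| ≤ 2 * |2 * π * x / M / 2| := by gcongr
      _ = 2 * |π * x| / M := by
        rw [show 2 * π * x / M / 2 = π * x / M by ring, abs_div, abs_of_pos hM']; ring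
  have h2 : ‖w ^ M - 1‖ = 2 * |sin (π * x)| := by
    have : w ^ M = Complex.exp (Complex.I * (2 * π * x : ℝ)) := by
      rw [hw, ← Complex.exp_nat_mul]
      congr 1
      have : (M : ℂ) ≠ 0 := by exact_mod_cast hM.ne'
      push_cast
      field_simp
    rw [this, Complex.norm_exp_I_mul_ofReal_sub_one, norm_mul, Real.norm_ofNat, Real.norm_eq_abs]
    congr 3
    ring
  have h3 : 2 * |sin (π * x)| ≤ ‖∑ j ∈ Finset.range M, w ^ j‖ * (2 * |π * x| / M) := by
    rw [← h2, ← geom_sum_mul, norm_mul]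
    gcongr
  have hpx : 0 < |π * x| := abs_pos.2 (mul_ne_zero pi_ne_zero hx)
  have h4 : |sin (π * x)| / |π * x| ≤ ‖(1 / M : ℂ) * ∑ j ∈ Finset.range M, w ^ j‖ := by
    rw [norm_mul, norm_div, norm_one, Complex.norm_natCast, div_le_iff₀ hpx]
    calc |sin (π * x)| = (2 * |sin (π * x)|) / 2 := by ring
      _ ≤ ‖∑ j ∈ Finset.range M, w ^ j‖ * (2 * |π * x| / M) / 2 := by gcongr
      _ = _ := by ring
  rw [← sq_abs (sin _), ← sq_abs (π * x), ← div_pow]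
  unfold phaseKernel
  gcongr

theorem eight_le_inv_sq_add_inv_sq {x : ℝ} (h0 : 0 < x) (h1 : x < 1) :
    8 ≤ 1 / x ^ 2 + 1 / (1 - x) ^ 2 := by
  -- The tangent of the convex function `1/u²` at `u = 1/2`; adding it at `x` and `1 - x` gives 8.
  have key : ∀ u : ℝ, 0 < u → 12 - 16 * u ≤ 1 / u ^ 2 := by
    intro u hu
    rw [le_div_iff₀ (by positivity)]
    nlinarith [mul_nonneg (sq_nonneg (2 * u - 1)) (by linarith : (0 : ℝ) ≤ 4 * u + 1)]
  linarith [key x h0, key (1 - x) (by linarith)]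

theorem le_sin_of_le {t : ℝ} (h0 : 0 ≤ t) (h1 : t ≤ 11 / 10) : 157 / 200 * t ≤ sin t := by
  rcases h0.eq_or_lt with rfl | h0
  · simp
  have hs : t - t ^ 3 / 6 < sin t := Real.sin_gt_sub_cube h0
  have ht : t * t ^ 2 ≤ t * (121 / 100) := by gcongr; nlinarith
  nlinarith

/-- By symmetry `x ≤ 1/2`. For `πx ≤ 1.1` the nearer point alone suffices, since `sin t ≥ 0.785 t`
there. Otherwise `sin πx ≥ 0.785 · 1.1`, and the inverse squares add up to at least 8. The median
needs only some bound above `1/2`. -/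
theorem two_nearest_ge {x : ℝ} (h0 : 0 < x) (h1 : x < 1) :
    57 / 100 ≤ sin (π * x) ^ 2 / (π * x) ^ 2 + sin (π * (x - 1)) ^ 2 / (π * (x - 1)) ^ 2 := by
  have hs : sin (π * (x - 1)) ^ 2 = sin (π * x) ^ 2 := by
    rw [mul_sub, mul_one, sin_sub_pi, neg_sq]
  rw [hs]
  wlog hx : x ≤ 1 / 2 generalizing x with H
  · have := H (x := 1 - x) (by linarith) (by linarith) (by
      rw [show π * (1 - x - 1) = -(π * x) by ring, show π * (1 - x) = π - π * x by ring,
        sin_neg, sin_pi_sub, neg_sq]) (by linarith)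
    rw [show π * (1 - x) = π - π * x by ring, sin_pi_sub] at this
    rw [show (π * (x - 1)) ^ 2 = (π - π * x) ^ 2 by ring, add_comm]
    rwa [show (π * (1 - x - 1)) ^ 2 = (π * x) ^ 2 by ring] at this
  have hpi := pi_pos
  have hpx : 0 < π * x := by positivity
  by_cases ht : π * x ≤ 11 / 10
  · have h2 := le_sin_of_le hpx.le ht
    have h3 : 57 / 100 ≤ sin (π * x) ^ 2 / (π * x) ^ 2 := by
      rw [le_div_iff₀ (by positivity)]
      nlinarith [pow_le_pow_left₀ (by positivity) h2 2, sq_nonneg (π * x)]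
    have : 0 ≤ sin (π * x) ^ 2 / (π * (x - 1)) ^ 2 := by positivity
    linarith
  · push Not at ht
    have h2 : 157 / 200 * (11 / 10) ≤ sin (π * x) :=
      (le_sin_of_le (by norm_num) le_rfl).trans
        (sin_le_sin_of_le_of_le_pi_div_two (by linarith) (by nlinarith) ht.le)
    have h3 : (157 / 200 * (11 / 10)) ^ 2 ≤ sin (π * x) ^ 2 :=
      pow_le_pow_left₀ (by norm_num) h2 2
    have h4 : π ^ 2 ≤ 9.88 := by nlinarith [pi_lt_d4]
    have h5 := eight_le_inv_sq_add_inv_sq h0 h1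
    have e : sin (π * x) ^ 2 / (π * x) ^ 2 + sin (π * x) ^ 2 / (π * (x - 1)) ^ 2 =
        sin (π * x) ^ 2 / π ^ 2 * (1 / x ^ 2 + 1 / (1 - x) ^ 2) := by
      have : x - 1 ≠ 0 := by linarith
      have : 1 - x ≠ 0 := by linarith
      rw [show (1 - x) ^ 2 = (x - 1) ^ 2 by ring]
      field_simp
    rw [e]
    calc (57 / 100 : ℝ) ≤ (157 / 200 * (11 / 10)) ^ 2 / 9.88 * 8 := by norm_num
      _ ≤ sin (π * x) ^ 2 / π ^ 2 * (1 / x ^ 2 + 1 / (1 - x) ^ 2) := by gcongr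

theorem abs_sin_sq_sub_sin_sq_le (x y : ℝ) : |sin x ^ 2 - sin y ^ 2| ≤ |x - y| := by
  have : sin x ^ 2 - sin y ^ 2 = sin (x - y) * sin (x + y) := by
    rw [sin_sub, sin_add]
    nlinarith [sin_sq_add_cos_sq x, sin_sq_add_cos_sq y]
  rw [this, abs_mul]
  calc |sin (x - y)| * |sin (x + y)| ≤ |x - y| * 1 := by
        exact mul_le_mul Real.abs_sin_le_abs (abs_sin_le_one _) (abs_nonneg _) (abs_nonneg _)
    _ = _ := mul_one _

/-- The outcomes of phase estimation that yield a good estimate of `sin² θ`. -/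
noncomputable def goodOutcomes (M : ℕ) (θ : ℝ) : Finset (Fin M) :=
  Finset.univ.filter fun l => |sin (π * (l : ℕ) / M) ^ 2 - sin θ ^ 2| ≤ π / M

theorem exists_outcome {M : ℕ} (hM : 0 < M) (n : ℤ) :
    ∃ l : Fin M, ∃ m : ℤ, ((l : ℕ) : ℤ) = n + m * M := by
  have hM' : (0 : ℤ) < M := by exact_mod_cast hM
  refine ⟨⟨(n % M).toNat, ?_⟩, -(n / M), ?_⟩
  · have := Int.emod_lt_of_pos n hM'
    have := Int.emod_nonneg n hM'.ne'
    omega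
  · have := Int.emod_nonneg n hM'.ne'
    have h := Int.emod_add_mul_ediv n M
    simp only
    rw [Int.toNat_of_nonneg this]
    linarith

/-- Write `Mθ/π = n + x` with `0 ≤ x < 1`. The outcomes congruent to `n` and `n + 1` modulo `M` are
both good; wrapping around shifts the angles by multiples of `π` in `sin²` and of `2π` in the
kernel, which changes nothing. -/
theorem sum_phaseKernel_ge {M : ℕ} (hM : 2 ≤ M) (θ : ℝ) :
    57 / 100 ≤ ∑ l ∈ goodOutcomes M θ, phaseKernel M (2 * θ - 2 * π * (l : ℕ) / M) := by
  have hM0 : 0 < M := by omega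
  have hM' : (0 : ℝ) < M := by exact_mod_cast hM0
  have hpi := pi_pos
  set n := ⌊M * θ / π⌋ with hn
  set x := Int.fract (M * θ / π) with hx
  have hx0 : 0 ≤ x := Int.fract_nonneg _
  have hx1 : x < 1 := Int.fract_lt_one _
  have hθ : θ = π * (n + x) / M := by
    rw [hn, hx, Int.floor_add_fract]
    field_simp
  have key : ∀ (r : ℤ) (l : Fin M) (m : ℤ), ((l : ℕ) : ℤ) = n + r + m * M → |x - r| ≤ 1 →
      l ∈ goodOutcomes M θ ∧ phaseKernel M (2 * θ - 2 * π * (l : ℕ) / M) =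
        phaseKernel M (2 * π * (x - r) / M) := by
    intro r l m hl hr
    have hl' : ((l : ℕ) : ℝ) = n + r + m * M := by exact_mod_cast hl
    constructor
    · refine Finset.mem_filter.2 ⟨Finset.mem_univ _, ?_⟩
      have e : π * (l : ℕ) / M = (θ - π * (x - r) / M) + m * π := by
        rw [hl', hθ]; field_simp; ring
      rw [e]
      have e2 : sin ((θ - π * (x - r) / M) + m * π) ^ 2 = sin (θ - π * (x - r) / M) ^ 2 := by
        rw [Real.sin_add_int_mul_pi, mul_pow]
        rcases Int.even_or_odd m with h | h
        · simp [h.neg_one_zpow]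
        · simp [h.neg_one_zpow]
      rw [e2]
      refine (abs_sin_sq_sub_sin_sq_le _ _).trans ?_
      rw [sub_sub_cancel_left, abs_neg, abs_div, abs_mul, abs_of_pos hpi, abs_of_pos hM']
      gcongr
      nlinarith
    · rw [← phaseKernel_add_int_mul_two_pi M _ m]
      congr 1
      rw [hl', hθ]; field_simp; ring
  obtain ⟨l, m, hl⟩ := exists_outcome hM0 (n + (0 : ℤ))
  obtain ⟨l', m', hl'⟩ := exists_outcome hM0 (n + (1 : ℤ))
  have k0 := key 0 l m hl (by rw [abs_le]; push_cast; constructor <;> linarith)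
  have k1 := key 1 l' m' hl' (by rw [abs_le]; push_cast; constructor <;> linarith)
  -- For `x = 0` the eigenphase is a grid point and a single outcome has kernel 1. For `x > 0` both
  -- neighbours are needed; they are distinct because `M ≥ 2`.
  rcases hx0.eq_or_lt with h0 | h0
  · refine le_trans ?_ (Finset.single_le_sum (fun _ _ => phaseKernel_nonneg _ _) k0.1)
    rw [k0.2, ← h0]
    simp only [Int.cast_zero, sub_zero, mul_zero, zero_div, phaseKernel_zero hM0]
    norm_num
  · have hne : l ≠ l' := by
      rintro rfl
      have h : (m - m') * (M : ℤ) = 1 := by linarith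
      have := Int.le_of_dvd one_pos ⟨m - m', by rw [← h, mul_comm]⟩
      omega
    refine le_trans ?_ (Finset.sum_le_sum_of_subset_of_nonneg (s := {l, l'}) ?_
      fun _ _ _ => phaseKernel_nonneg _ _)
    · rw [Finset.sum_pair hne, k0.2, k1.2]
      refine (two_nearest_ge h0 hx1).trans (add_le_add ?_ ?_)
      · simpa using le_phaseKernel hM0 h0.ne'
      · simpa using le_phaseKernel hM0 (x := x - 1) (by linarith)
    · intro i hi
      rcases Finset.mem_insert.1 hi with rfl | hi
      · exact k0.1
      · rw [Finset.mem_singleton.1 hi]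
        exact k1.1

/-! ### The outcome of amplitude estimation -/

/-- Each use of `Q` rotates by `2θ`. Keeping the factors `cos θ` and `sin θ` on the left covers `q =
0` and `q = 1` without division. -/
theorem groverCoeff_eq {q θ : ℝ} (hq : sin θ ^ 2 = q) (n : ℕ) :
    cos θ * (groverCoeff q n).1 = cos ((2 * n + 1) * θ) ∧
      sin θ * (groverCoeff q n).2 = sin ((2 * n + 1) * θ) := by
  induction n with
  | zero => simp [groverCoeff]
  | succ n ih =>
    obtain ⟨h1, h2⟩ := ih
    have hc : 1 - q = cos θ ^ 2 := by rw [← hq]; linarith [sin_sq_add_cos_sq θ]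
    have e : (2 * ((n + 1 : ℕ) : ℝ) + 1) * θ = (2 * n + 1) * θ + 2 * θ := by push_cast; ring
    rw [e, cos_add, sin_add, ← h1, ← h2, cos_two_mul, sin_two_mul, groverCoeff, hc, ← hq]
    constructor
    · ring
    · linear_combination (-2 * sin θ * (groverCoeff (sin θ ^ 2) n).2) * sin_sq_add_cos_sq θ

theorem le_born {d p N T : ℕ} {ι : Type*} (ψ : State d p N T) (l : Fin (T + 1)) (s : Finset ι)
    (u : ι → Label d p N T) (hu : Function.Injective u) (hl : ∀ i ∈ s, (u i).phase = l) :
    ∑ i ∈ s, ‖ψ (u i)‖ ^ 2 ≤ born ψ l := by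
  classical
  rw [← Finset.sum_image (f := fun e => ‖ψ e‖ ^ 2) (s := s) (g := u) hu.injOn, born]
  have : ∑ e ∈ (s.image u).filter (fun e => ψ e ≠ 0), ‖ψ e‖ ^ 2 =
      ∑ e ∈ s.image u, ‖ψ e‖ ^ 2 := by
    refine Finset.sum_filter_of_ne fun e _ he h0 => he ?_
    simp [h0]
  rw [← this]
  refine Finset.sum_le_sum_of_subset_of_nonneg (fun e he => ?_) fun _ _ _ => by positivity
  rw [Finset.mem_filter, Finset.mem_image] at he
  obtain ⟨⟨i, hi, rfl⟩, h0⟩ := he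
  simp [h0, hl i hi]

/-- The parallelogram law, used to pass from cosine and sine amplitudes to the two eigenphases. -/
theorem norm_sq_add_norm_sq (u v : ℂ) :
    ‖u‖ ^ 2 + ‖v‖ ^ 2 = (‖u + v * Complex.I‖ ^ 2 + ‖u - v * Complex.I‖ ^ 2) / 2 := by
  have := parallelogram_law_with_norm ℝ u (v * Complex.I)
  rw [norm_mul, Complex.norm_I, mul_one] at this
  nlinarith

theorem inv_sqrt_mul_fourierCoeff (M : ℕ) (j l : Fin M) :
    ((1 / √M : ℝ) : ℂ) * fourierCoeff M true j l =
      1 / M * Complex.exp (-(2 * π * Complex.I * (j : ℕ) * (l : ℕ) / M)) := by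
  have h1 : ((1 / √(M : ℝ) : ℝ) : ℂ) * ((1 / √(M : ℝ) : ℝ) : ℂ) = 1 / M := by
    rw [← Complex.ofReal_mul, div_mul_div_comm, Real.mul_self_sqrt (Nat.cast_nonneg M)]
    simp
  rw [fourierCoeff, ← mul_assoc, h1, if_pos rfl, neg_one_mul]

theorem norm_sum_phase (M : ℕ) (l : Fin M) (θ : ℝ) :
    ‖∑ j : Fin M, ((1 / √M : ℝ) : ℂ) * fourierCoeff M true j l *
      Complex.exp ((2 * (j : ℕ) + 1) * θ * Complex.I)‖ ^ 2 =
      phaseKernel M (2 * θ - 2 * π * (l : ℕ) / M) := by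
  have : ∀ j : Fin M, ((1 / √M : ℝ) : ℂ) * fourierCoeff M true j l *
      Complex.exp ((2 * (j : ℕ) + 1) * θ * Complex.I) =
      Complex.exp (θ * Complex.I) * (1 / M * Complex.exp
        (Complex.I * (2 * θ - 2 * π * (l : ℕ) / M : ℝ)) ^ (j : ℕ)) := by
    intro j
    rw [inv_sqrt_mul_fourierCoeff, mul_assoc, ← Complex.exp_add, mul_left_comm,
      ← Complex.exp_nat_mul, ← Complex.exp_add]
    congr 2
    push_cast
    ring
  simp_rw [this]
  rw [← Finset.mul_sum, norm_mul, Complex.norm_exp_ofReal_mul_I, one_mul, ← Finset.mul_sum,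
    Fin.sum_univ_eq_sum_range (fun j => Complex.exp
      (Complex.I * (2 * θ - 2 * π * (l : ℕ) / M : ℝ)) ^ j)]
  rfl

section Outcome

variable {d p N T : ℕ} [NeZero N] (f : Pt d → Par p → ℝ) (c : Fin N → Par p) (B : ℝ)

/-- At each label of the outcome `l`, the amplitude is the branch coefficient times a Fourier sum
that does not depend on `k`. Summing the squares over `k` leaves a cosine and a sine sum, which
combine into the exponentials `exp(±i(2j+1)θ)`. A lower bound suffices, so other labels are ignored.
-/
theorem born_ampEst_ge (t : Target d) (a : Pt d) {θ : ℝ} (hθ : sin θ ^ 2 = flagProb f c B t a)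
    (l : Fin (T + 1)) :
    (phaseKernel (T + 1) (2 * θ - 2 * π * (l : ℕ) / (T + 1 : ℕ)) +
      phaseKernel (T + 1) (2 * (-θ) - 2 * π * (l : ℕ) / (T + 1 : ℕ))) / 2 ≤
      born (runCircuit f c B (ampEst t T) (ket (initLabel a))) l := by
  set κ : Fin (T + 1) → ℂ := fun j => ((1 / √(T + 1 : ℕ) : ℝ) : ℂ) * fourierCoeff (T + 1) true j l
    with hκ
  set g := groverCoeff (flagProb f c B t a)
  have happ : ∀ y k, runCircuit f c B (ampEst t T) (ket (initLabel a))
      (branchLabel f c t a y l k) =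
      branchCoeff f c B t a y k * ∑ j, κ j * ((if y then (g j).2 else (g j).1 : ℝ) : ℂ) := by
    intro y k
    change circuitMap f c B (ampEst t T) (ket (initLabel a)) _ = _
    rw [circuitMap_ampEst, Finsupp.finsetSum_apply, Finset.sum_eq_single l]
    · rw [Finsupp.finsetSum_apply, Finset.mul_sum]
      refine Finset.sum_congr rfl fun j _ => ?_
      cases y <;> simp [rotated, branch_apply, hκ, g] <;> ring
    · intro l' _ hl'
      rw [Finsupp.finsetSum_apply]
      refine Finset.sum_eq_zero fun j _ => ?_
      simp [rotated, branch_apply, hl']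
    · simp
  refine le_trans (le_of_eq ?_) (le_born _ l (Finset.univ : Finset (Bool × Fin N))
    (fun i => branchLabel f c t a i.1 l i.2)
    (fun i i' h => Prod.ext (branchLabel_inj f c |>.1 h).1 (branchLabel_inj f c |>.1 h).2.2)
    fun _ _ => rfl)
  rw [Fintype.sum_prod_type, Fintype.sum_bool]
  simp_rw [happ, norm_mul, mul_pow, Complex.norm_real, Real.norm_eq_abs, sq_abs]
  rw [← Finset.sum_mul, ← Finset.sum_mul, sum_branchCoeff_sq, sum_branchCoeff_sq]
  have hc : 1 - flagProb f c B t a = cos θ ^ 2 := by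
    rw [← hθ]; linarith [sin_sq_add_cos_sq θ]
  simp only [if_true, Bool.false_eq_true, if_false]
  rw [hc, ← hθ]
  have hu : cos θ ^ 2 * ‖∑ j, κ j * ((g j).1 : ℂ)‖ ^ 2 =
      ‖∑ j, κ j * Complex.cos ((2 * (j : ℕ) + 1) * θ)‖ ^ 2 := by
    rw [← sq_abs (cos θ), ← Real.norm_eq_abs, ← Complex.norm_real, ← mul_pow, ← norm_mul,
      Finset.mul_sum]
    congr 3
    ext j
    have := (groverCoeff_eq hθ j).1
    rw [mul_left_comm, ← Complex.ofReal_mul, this]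
    push_cast
    rfl
  have hv : sin θ ^ 2 * ‖∑ j, κ j * ((g j).2 : ℂ)‖ ^ 2 =
      ‖∑ j, κ j * Complex.sin ((2 * (j : ℕ) + 1) * θ)‖ ^ 2 := by
    rw [← sq_abs (sin θ), ← Real.norm_eq_abs, ← Complex.norm_real, ← mul_pow, ← norm_mul,
      Finset.mul_sum]
    congr 3
    ext j
    have := (groverCoeff_eq hθ j).2
    rw [mul_left_comm, ← Complex.ofReal_mul, this]
    push_cast
    rfl
  rw [hu, hv, add_comm (‖_‖ ^ 2), norm_sq_add_norm_sq, ← norm_sum_phase, ← norm_sum_phase,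
    Finset.sum_mul, ← Finset.sum_add_distrib, ← Finset.sum_sub_distrib]
  congr 5
  · ext j
    rw [Complex.exp_mul_I]
    ring
  · ext j
    rw [show ((2 * ((j : ℕ) : ℂ) + 1) * ((-θ : ℝ) : ℂ)) = -((2 * ((j : ℕ) : ℂ) + 1) * θ) by
      push_cast; ring, Complex.exp_mul_I, Complex.cos_neg, Complex.sin_neg]
    ring

theorem flagProb_le_one (t : Target d) (a : Pt d) : flagProb f c B t a ≤ 1 := by
  have hN : (0 : ℝ) < N := by exact_mod_cast NeZero.pos N
  have : ∑ k, encoded f c B t a k ≤ ∑ k : Fin N, (1 : ℝ) :=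
    Finset.sum_le_sum fun _ _ => encode_le_one _ _
  rw [flagProb, one_div_mul_eq_div, div_le_one hN]
  simpa using this

theorem sum_born_ampEst_ge (hT : 1 ≤ T) (t : Target d) (a : Pt d) :
    57 / 100 ≤ ∑ l ∈ Finset.univ.filter fun l : Fin (T + 1) =>
      |sin (π * (l : ℕ) / (T + 1)) ^ 2 - flagProb f c B t a| ≤ π / (T + 1),
      born (runCircuit f c B (ampEst t T) (ket (initLabel a))) l := by
  have h0 := flagProb_nonneg f c B t a
  have h1 := flagProb_le_one f c B t a
  set θ := arcsin (√(flagProb f c B t a)) with hθ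
  have hs : sin θ ^ 2 = flagProb f c B t a := by
    rw [hθ, sin_arcsin (by linarith [sqrt_nonneg (flagProb f c B t a)]) (sqrt_le_one.2 h1),
      sq_sqrt h0]
  -- Both eigenphases `±2θ` have the same good outcomes, since `sin²` is even.
  have hgood : ∀ θ' : ℝ, sin θ' ^ 2 = sin θ ^ 2 → goodOutcomes (T + 1) θ' =
      Finset.univ.filter fun l : Fin (T + 1) =>
        |sin (π * (l : ℕ) / (T + 1)) ^ 2 - flagProb f c B t a| ≤ π / (T + 1) := by
    intro θ' h
    unfold goodOutcomes
    rw [h, hs]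
    push_cast
    rfl
  refine le_trans ?_ (Finset.sum_le_sum fun l _ => born_ampEst_ge f c B t a hs l)
  rw [← Finset.sum_div, Finset.sum_add_distrib]
  have k1 := sum_phaseKernel_ge (M := T + 1) (by omega) θ
  have k2 := sum_phaseKernel_ge (M := T + 1) (by omega) (-θ)
  rw [hgood _ rfl] at k1
  rw [hgood _ (by rw [sin_neg, neg_sq])] at k2
  linarith

theorem expect_lift {α : Type} (m : PMF α) (g : α → ENNReal) (s : Calls) :
    expect (StateT.lift m : Comp α) g s = ∑' y, m y * g y := by
  unfold expect
  have : (StateT.lift m : Comp α).run s = m.bind fun y => PMF.pure (y, s) := rfl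
  rw [this]
  simp_rw [PMF.bind_apply, ← ENNReal.tsum_mul_right, mul_assoc]
  rw [ENNReal.tsum_comm]
  simp_rw [ENNReal.tsum_mul_left]
  refine tsum_congr fun y => ?_
  congr 1
  rw [tsum_eq_single (y, s)]
  · simp
  · intro x hx
    simp [PMF.pure_apply, hx]

theorem failLE_ampEstRun (hT : 1 ≤ T) (t : Target d) (a : Pt d) :
    FailLE (ampEstRun f c B t T a)
      (fun x => flagProb f c B t a - π / (T + 1) ≤ x ∧ x ≤ flagProb f c B t a + π / (T + 1))
      (ENNReal.ofReal (43 / 100)) := by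
  classical
  unfold ampEstRun
  rw [← zero_add (ENNReal.ofReal _)]
  refine FailLE.bind (G := fun _ => True) ((expectLE_const _ 0).mono (by simp) le_rfl)
    fun _ _ => FailLE.bind_pure (G := fun l : Fin (T + 1) =>
      |sin (π * (l : ℕ) / (T + 1)) ^ 2 - flagProb f c B t a| ≤ π / (T + 1)) ?_ ?_
  · intro s
    rw [expect_lift, tsum_fintype]
    set ψ : State d p N T := runCircuit f c B (ampEst t T) (ket (initLabel a)) with hψ
    have hb : ∀ l, 0 ≤ born ψ l := fun l => Finset.sum_nonneg fun _ _ => by positivity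
    have hsum : ∑ l, born ψ l = 1 := by
      have := sum_born ψ (by rw [hψ, dot_runCircuit, dot_single, if_pos rfl])
      rw [← ENNReal.ofReal_sum_of_nonneg fun l _ => hb l, ENNReal.ofReal_eq_one] at this
      exact this
    have hge := sum_born_ampEst_ge f c B hT t a
    rw [← Finset.sum_filter_add_sum_filter_not Finset.univ (fun l : Fin (T + 1) =>
      |sin (π * (l : ℕ) / (T + 1)) ^ 2 - flagProb f c B t a| ≤ π / (T + 1))] at hsum
    have happ : ∀ l, measurePhase f c B T (ampEst t T) a l = ENNReal.ofReal (born ψ l) :=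
      fun l => rfl
    simp_rw [happ, mul_ite, mul_zero, mul_one]
    rw [Finset.sum_ite, Finset.sum_const_zero, zero_add,
      ← ENNReal.ofReal_sum_of_nonneg fun l _ => hb l]
    refine ENNReal.ofReal_le_ofReal ?_
    linarith
  · intro l hl
    rw [abs_le] at hl
    constructor <;> linarith

theorem failLE_estimate {s : ℕ} (hB : 0 < B) (hT : 1 ≤ T) (t : Target d) (a : Pt d)
    (hv : ∀ k, |partialDeriv f t a (c k)| ≤ B) :
    FailLE (estimate f c B T s a t)
      (fun x => |x - 1 / N * ∑ k, partialDeriv f t a (c k)| ≤ 2 * π * B / (T + 1))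
      (ENNReal.ofReal ((981 / 1000) ^ s)) := by
  have hN : (0 : ℝ) < N := by exact_mod_cast NeZero.pos N
  refine FailLE.bind_pure (failLE_median _ _ _ fun _ => failLE_ampEstRun f c B hT t a)
    fun v hm => ?_
  -- The bound `B` makes the truncation inactive, so encoding is affine and commutes with the
  -- average.
  have e : ∀ k, encoded f c B t a k = (1 + partialDeriv f t a (c k) / B) / 2 := by
    intro k
    have h := abs_le.1 (hv k)
    have h1 : partialDeriv f t a (c k) / B ≤ 1 := (div_le_one hB).2 h.2
    have h2 : -1 ≤ partialDeriv f t a (c k) / B := by rw [le_div_iff₀ hB]; linarith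
    rw [encoded, encode, min_eq_right (by linarith), max_eq_right (by linarith)]
  have hq : B * (2 * flagProb f c B t a - 1) = 1 / N * ∑ k, partialDeriv f t a (c k) := by
    simp only [flagProb, e, ← Finset.sum_div, Finset.sum_add_distrib, Finset.sum_const,
      Finset.card_univ, Fintype.card_fin, nsmul_eq_mul]
    field_simp
    ring
  rw [← hq, ← mul_sub, abs_mul, abs_of_pos hB, mul_right_comm 2 π B, mul_comm (2 * B) π,
    mul_div_right_comm]
  have : |2 * median v - 1 - (2 * flagProb f c B t a - 1)| ≤ 2 * (π / (T + 1)) := by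
    rw [abs_le]
    constructor <;> linarith [hm.1, hm.2]
  calc B * |2 * median v - 1 - (2 * flagProb f c B t a - 1)| ≤ B * (2 * (π / (T + 1))) := by
        gcongr
    _ = _ := by ring

end Outcome

/-! ### Derivatives of the objective -/

section Derivatives

variable {d p N : ℕ}

theorem gradient_apply {F : Pt d → ℝ} (a : Pt d) (i : Fin d) :
    gradient F a i = fderiv ℝ F a (EuclideanSpace.single i 1) := by
  have h : inner ℝ (gradient F a) (EuclideanSpace.single i 1) =
      fderiv ℝ F a (EuclideanSpace.single i 1) :=
    InnerProductSpace.toDual_symm_apply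
  rw [← h, EuclideanSpace.inner_single_right]
  simp

theorem TwiceDifferentiable.hasFDerivAt_gradient {F : Pt d → ℝ} (hF : TwiceDifferentiable F)
    (a : Pt d) : HasFDerivAt (gradient F) (hessian F a) a := by
  have : gradient F = fun x => (InnerProductSpace.toDual ℝ (Pt d)).symm (fderiv ℝ F x) := rfl
  refine DifferentiableAt.hasFDerivAt ?_
  rw [this]
  exact ((InnerProductSpace.toDual ℝ (Pt d)).symm.toContinuousLinearEquiv.differentiable _).comp
    a (hF.2 a)

theorem TwiceDifferentiable.hessian_apply_apply {F : Pt d → ℝ} (hF : TwiceDifferentiable F)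
    (a v : Pt d) (i : Fin d) :
    hessian F a v i = fderiv ℝ (fderiv ℝ F) a v (EuclideanSpace.single i 1) := by
  have h1 : HasFDerivAt (fun x => gradient F x i)
      ((EuclideanSpace.proj i : Pt d →L[ℝ] ℝ).comp (hessian F a)) a :=
    (EuclideanSpace.proj i : Pt d →L[ℝ] ℝ).hasFDerivAt.comp a (hF.hasFDerivAt_gradient a)
  have h2 : HasFDerivAt (fun x => fderiv ℝ F x (EuclideanSpace.single i 1))
      ((fderiv ℝ (fderiv ℝ F) a).flip (EuclideanSpace.single i 1)) a :=
    (ContinuousLinearMap.apply ℝ ℝ (EuclideanSpace.single i 1 : Pt d)).hasFDerivAt.comp a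
      (hF.2 a).hasFDerivAt
  have e : (fun x => gradient F x i) = fun x => fderiv ℝ F x (EuclideanSpace.single i 1) := by
    ext x
    exact gradient_apply x i
  rw [e] at h1
  exact congrArg (fun L : Pt d →L[ℝ] ℝ => L v) (h1.unique h2)

theorem TwiceDifferentiable.second_symm {F : Pt d → ℝ} (hF : TwiceDifferentiable F)
    (a v w : Pt d) : fderiv ℝ (fderiv ℝ F) a v w = fderiv ℝ (fderiv ℝ F) a w v :=
  second_derivative_symmetric (fun x => (hF.1 x).hasFDerivAt) (hF.2 a).hasFDerivAt v w

variable {f : Pt d → Par p → ℝ} {c : Fin N → Par p}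

theorem hasFDerivAt_objective (hf : ∀ k, TwiceDifferentiable fun a => f a (c k)) (a : Pt d) :
    HasFDerivAt (objective f c) ((1 / (N : ℝ)) • ∑ k, fderiv ℝ (fun x => f x (c k)) a) a :=
  (HasFDerivAt.fun_sum fun k _ => ((hf k).1 a).hasFDerivAt).const_mul _

theorem hasFDerivAt_fderiv_objective (hf : ∀ k, TwiceDifferentiable fun a => f a (c k))
    (a : Pt d) : HasFDerivAt (fderiv ℝ (objective f c))
      ((1 / (N : ℝ)) • ∑ k, fderiv ℝ (fderiv ℝ fun x => f x (c k)) a) a := by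
  have : fderiv ℝ (objective f c) =
      fun x => (1 / (N : ℝ)) • ∑ k, fderiv ℝ (fun x => f x (c k)) x := by
    ext1 x
    exact (hasFDerivAt_objective hf x).fderiv
  rw [this]
  exact HasFDerivAt.fun_const_smul (F := Pt d →L[ℝ] ℝ)
    (HasFDerivAt.fun_sum fun k _ => ((hf k).2 a).hasFDerivAt) (1 / (N : ℝ))

theorem twiceDifferentiable_objective (hf : ∀ k, TwiceDifferentiable fun a => f a (c k)) :
    TwiceDifferentiable (objective f c) :=
  ⟨fun a => (hasFDerivAt_objective hf a).differentiableAt,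
    fun a => (hasFDerivAt_fderiv_objective hf a).differentiableAt⟩

theorem gradient_objective_apply (hf : ∀ k, TwiceDifferentiable fun a => f a (c k)) (a : Pt d)
    (i : Fin d) :
    gradient (objective f c) a i = 1 / N * ∑ k, partialDeriv f (.first i) a (c k) := by
  rw [gradient_apply, (hasFDerivAt_objective hf a).fderiv]
  simp [partialDeriv]

theorem hessian_objective_apply (hf : ∀ k, TwiceDifferentiable fun a => f a (c k)) (a : Pt d)
    (i j : Fin d) :
    hessian (objective f c) a (EuclideanSpace.single j 1) i =
      1 / N * ∑ k, partialDeriv f (.second i j) a (c k) := by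
  have hF := twiceDifferentiable_objective hf
  -- The Hessian entry differentiates along `i` first, `partialDeriv` along `j` first; symmetry of
  -- the second derivative reconciles them.
  rw [hF.hessian_apply_apply, hF.second_symm, (hasFDerivAt_fderiv_objective hf a).fderiv]
  have : ∀ k, partialDeriv f (.second i j) a (c k) =
      fderiv ℝ (fderiv ℝ fun x => f x (c k)) a (EuclideanSpace.single i 1)
        (EuclideanSpace.single j 1) := by
    intro k
    have h : HasFDerivAt
        (fun x => fderiv ℝ (fun x => f x (c k)) x (EuclideanSpace.single j 1))
        ((fderiv ℝ (fderiv ℝ fun x => f x (c k)) a).flip (EuclideanSpace.single j 1)) a :=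
      (ContinuousLinearMap.apply ℝ ℝ (EuclideanSpace.single j 1 : Pt d)).hasFDerivAt.comp a
        ((hf k).2 a).hasFDerivAt
    simp only [partialDeriv]
    rw [h.fderiv]
    rfl
  simp [this]

end Derivatives

/-! ### Strongly convex functions with Lipschitz Hessian -/

section Convex

variable {d : ℕ} {F : Pt d → ℝ} {μ M : ℝ}

/-- The strong convexity inequalities for `(a, b)` and `(b, a)`, added. -/
theorem StronglyConvex.inner_gradient_sub (h : StronglyConvex μ F) (a b : Pt d) :
    μ * ‖a - b‖ ^ 2 ≤ inner ℝ (gradient F a - gradient F b) (a - b) := by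
  have h1 := h a b
  have h2 := h b a
  rw [norm_sub_rev b a, ← neg_sub a b, inner_neg_right] at h2
  rw [inner_sub_left]
  linarith

theorem StronglyConvex.norm_gradient_sub (h : StronglyConvex μ F) (a b : Pt d) :
    μ * ‖a - b‖ ≤ ‖gradient F a - gradient F b‖ := by
  rcases eq_or_ne a b with rfl | hab
  · simp
  have hpos : 0 < ‖a - b‖ := norm_pos_iff.2 (sub_ne_zero.2 hab)
  have := (h.inner_gradient_sub a b).trans (real_inner_le_norm _ _)
  refine le_of_mul_le_mul_right ?_ hpos
  linarith

/-- The limit `t → 0⁺` of strong monotonicity of the gradient between `a` and `a + t v`, divided by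
`t²`. -/
theorem StronglyConvex.inner_hessian (h : StronglyConvex μ F) (hF : TwiceDifferentiable F)
    (a v : Pt d) : μ * ‖v‖ ^ 2 ≤ inner ℝ (hessian F a v) v := by
  have hd : HasDerivAt (fun t : ℝ => inner ℝ (gradient F (a + t • v)) v)
      (inner ℝ (hessian F a v) v) 0 := by
    have h1 : HasDerivAt (fun t : ℝ => a + t • v) v 0 := by
      simpa using ((hasDerivAt_id (0 : ℝ)).smul_const v).const_add a
    have h2 : HasDerivAt (fun t : ℝ => gradient F (a + t • v)) (hessian F a v) 0 := by
      have h3 : HasFDerivAt (gradient F) (hessian F a) (a + (0 : ℝ) • v) := by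
        simpa using hF.hasFDerivAt_gradient a
      exact h3.comp_hasDerivAt 0 h1
    simpa using h2.inner ℝ (hasDerivAt_const (0 : ℝ) v)
  refine ge_of_tendsto hd.tendsto_slope_zero_right ?_
  filter_upwards [self_mem_nhdsWithin] with t ht
  have ht' : (0 : ℝ) < t := ht
  have := h.inner_gradient_sub (a + t • v) a
  rw [add_sub_cancel_left, norm_smul, inner_smul_right, Real.norm_eq_abs, abs_of_pos ht'] at this
  simp only [zero_add, zero_smul, add_zero, smul_eq_mul]
  rw [← inner_sub_left, inv_mul_eq_div, le_div_iff₀ ht']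
  refine le_of_mul_le_mul_left ?_ ht'
  linarith

theorem StronglyConvex.norm_hessian (h : StronglyConvex μ F) (hF : TwiceDifferentiable F)
    (a v : Pt d) : μ * ‖v‖ ≤ ‖hessian F a v‖ := by
  rcases eq_or_ne v 0 with rfl | hv
  · simp
  have hpos : 0 < ‖v‖ := norm_pos_iff.2 hv
  have := (h.inner_hessian hF a v).trans (real_inner_le_norm _ _)
  refine le_of_mul_le_mul_right ?_ hpos
  linarith

/-- Along the segment the remainder has derivative of norm at most `M t ‖v‖²`, the derivative of
`M/2 ‖v‖² t²`. The comparison form of the mean value inequality needs no integrability of the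
Hessian. -/
theorem LipschitzHessian.norm_taylor_le (h : LipschitzHessian M F) (hF : TwiceDifferentiable F)
    (a v : Pt d) :
    ‖gradient F (a + v) - gradient F a - hessian F a v‖ ≤ M / 2 * ‖v‖ ^ 2 := by
  have hd : ∀ t : ℝ, HasDerivAt (fun t : ℝ => gradient F (a + t • v) - gradient F a -
      t • hessian F a v) (hessian F (a + t • v) v - hessian F a v) t := by
    intro t
    have h1 : HasDerivAt (fun t : ℝ => a + t • v) v t := by
      simpa using ((hasDerivAt_id t).smul_const v).const_add a
    have h2 : HasDerivAt (fun t : ℝ => gradient F (a + t • v)) (hessian F (a + t • v) v) t :=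
      HasFDerivAt.comp_hasDerivAt (f := fun t : ℝ => a + t • v) t
        (hF.hasFDerivAt_gradient (a + t • v)) h1
    have h3 : HasDerivAt (fun t : ℝ => t • hessian F a v) (hessian F a v) t := by
      simpa using (hasDerivAt_id t).smul_const (hessian F a v)
    exact (h2.sub_const _).sub h3
  have hB : ∀ t : ℝ, HasDerivAt (fun t : ℝ => M / 2 * ‖v‖ ^ 2 * t ^ 2) (M * ‖v‖ ^ 2 * t) t := by
    intro t
    refine ((hasDerivAt_pow 2 t).const_mul (M / 2 * ‖v‖ ^ 2)).congr_deriv ?_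
    norm_num
    ring
  have := image_norm_le_of_norm_deriv_right_le_deriv_boundary (a := (0 : ℝ)) (b := 1)
    (fun t _ => (hd t).continuousAt.continuousWithinAt)
    (fun t _ => (hd t).hasDerivWithinAt) (by simp) hB (fun t ht => ?_)
    (Set.right_mem_Icc.2 zero_le_one)
  · simpa using this
  · rw [← sub_apply]
    refine (ContinuousLinearMap.le_opNorm _ _).trans ?_
    have := h (a + t • v) a
    rw [add_sub_cancel_left, norm_smul, Real.norm_eq_abs, abs_of_nonneg ht.1] at this
    calc _ ≤ M * (t * ‖v‖) * ‖v‖ := by gcongr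
      _ = _ := by ring

theorem gradient_eq_zero_of_isMin {aStar : Pt d} (h : ∀ a, F aStar ≤ F a) :
    gradient F aStar = 0 := by
  have : IsLocalMin F aStar := Filter.Eventually.of_forall h
  rw [gradient, this.fderiv_eq_zero, map_zero]

/-- One Newton update with an approximate gradient and Hessian. -/
theorem newton_update (hF : TwiceDifferentiable F) (hc : StronglyConvex μ F)
    (hL : LipschitzHessian M F) {aStar : Pt d} (hmin : ∀ a, F aStar ≤ F a) (a : Pt d)
    (g : Fin d → ℝ) (A : Matrix (Fin d) (Fin d) ℝ) {σg σH : ℝ}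
    (hg : ‖WithLp.toLp 2 g - gradient F a‖ ≤ σg)
    (hA : ∀ x : Pt d, ‖WithLp.toLp 2 (A.mulVec x) - hessian F a x‖ ≤ σH * ‖x‖) (hσ : σH < μ) :
    IsUnit A ∧ ‖a - WithLp.toLp 2 (A⁻¹.mulVec g) - aStar‖ ≤
      (σH * ‖a - aStar‖ + M / 2 * ‖a - aStar‖ ^ 2 + σg) / (μ - σH) := by
  -- An operator bounded below by `μ` stays bounded below by `μ - σH` after the perturbation; this
  -- yields both invertibility and the denominator.
  have hlow : ∀ x : Pt d, (μ - σH) * ‖x‖ ≤ ‖WithLp.toLp 2 (A.mulVec x)‖ := by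
    intro x
    have h1 := hc.norm_hessian hF a x
    have h2 := hA x
    have h3 := norm_sub_norm_le (hessian F a x) (hessian F a x - WithLp.toLp 2 (A.mulVec x))
    rw [sub_sub_cancel, norm_sub_rev (hessian F a x)] at h3
    linarith
  have hμ : 0 < μ - σH := sub_pos.2 hσ
  have hu : IsUnit A := by
    rw [← Matrix.mulVec_injective_iff_isUnit]
    refine (injective_iff_map_eq_zero A.mulVecLin).2 fun x hx => ?_
    have := hlow (WithLp.toLp 2 x)
    have hx' : A.mulVec x = 0 := hx
    simp only [hx', WithLp.toLp_zero, norm_zero] at this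
    have h0 : ‖WithLp.toLp 2 x‖ = 0 :=
      le_antisymm (nonpos_of_mul_nonpos_right this hμ) (norm_nonneg _)
    simpa using h0
  refine ⟨hu, ?_⟩
  set x := a - WithLp.toLp 2 (A⁻¹.mulVec g) - aStar with hx
  have hdet := (Matrix.isUnit_iff_isUnit_det A).1 hu
  -- `A` applied to the new error splits into the Hessian error, the Taylor remainder at the
  -- minimizer (whose gradient vanishes), and the gradient error.
  have hAx : WithLp.toLp 2 (A.mulVec x) =
      (WithLp.toLp 2 (A.mulVec (a - aStar)) - hessian F a (a - aStar)) +
      (gradient F (a + (aStar - a)) - gradient F a - hessian F a (aStar - a)) -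
      (WithLp.toLp 2 g - gradient F a) := by
    have e1 : A.mulVec x = A.mulVec (a - aStar) - g := by
      have : (x : Fin d → ℝ) = (a - aStar : Pt d) - A⁻¹.mulVec g := by
        rw [hx]
        ext i
        simp
        ring
      rw [this, Matrix.mulVec_sub, Matrix.mulVec_mulVec, Matrix.mul_nonsing_inv A hdet,
        Matrix.one_mulVec]
      rfl
    rw [e1, add_sub_cancel, gradient_eq_zero_of_isMin hmin, ← neg_sub a aStar, map_neg,
      WithLp.toLp_sub]
    abel
  rw [le_div_iff₀' hμ]
  refine (hlow x).trans ?_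
  rw [hAx]
  have t1 := hA (a - aStar)
  have t2 := hL.norm_taylor_le hF a (aStar - a)
  rw [norm_sub_rev aStar a] at t2
  refine (norm_sub_le _ _).trans (add_le_add ((norm_add_le _ _).trans (add_le_add t1 t2)) hg)

end Convex

/-! ### Errors of vectors and matrices from errors of their components -/

theorem norm_le_sqrt_mul_of_abs_le {d : ℕ} {x : Pt d} {η : ℝ} (hη : 0 ≤ η)
    (h : ∀ i, |x i| ≤ η) : ‖x‖ ≤ √d * η := by
  rw [EuclideanSpace.norm_eq]
  have : ∑ i, ‖x i‖ ^ 2 ≤ d * η ^ 2 := by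
    calc ∑ i, ‖x i‖ ^ 2 ≤ ∑ i : Fin d, η ^ 2 :=
          Finset.sum_le_sum fun i _ => pow_le_pow_left₀ (norm_nonneg _) (h i) 2
      _ = _ := by simp
  calc √(∑ i, ‖x i‖ ^ 2) ≤ √(d * η ^ 2) := Real.sqrt_le_sqrt this
    _ = _ := by rw [Real.sqrt_mul (Nat.cast_nonneg d), Real.sqrt_sq hη]

/-- One factor `√d` comes from Cauchy–Schwarz in each row, the other from combining the `d` rows. -/
theorem norm_mulVec_sub_le {d : ℕ} (A : Matrix (Fin d) (Fin d) ℝ) (H : Pt d →L[ℝ] Pt d) {η : ℝ}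
    (h : ∀ i j, |A i j - H (EuclideanSpace.single j 1) i| ≤ η) (x : Pt d) :
    ‖WithLp.toLp 2 (A.mulVec x) - H x‖ ≤ d * η * ‖x‖ := by
  rcases Nat.eq_zero_or_pos d with rfl | hd
  · simp [Subsingleton.elim x 0]
  have hη : 0 ≤ η := (abs_nonneg _).trans (h ⟨0, hd⟩ ⟨0, hd⟩)
  have hH : ∀ i, H x i = ∑ j, H (EuclideanSpace.single j 1) i * x j := by
    intro i
    conv_lhs => rw [← (EuclideanSpace.basisFun (Fin d) ℝ).sum_repr x]
    simp [map_sum, mul_comm]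
  have hrow : ∀ i, |(WithLp.toLp 2 (A.mulVec x) - H x) i| ≤ √d * η * ‖x‖ := by
    intro i
    have e : (WithLp.toLp 2 (A.mulVec x) - H x) i =
        inner ℝ x (WithLp.toLp 2 fun j => A i j - H (EuclideanSpace.single j 1) i) := by
      simp [hH, Matrix.mulVec, dotProduct, PiLp.inner_apply, sub_mul, Finset.sum_sub_distrib]
    rw [e, mul_comm]
    refine (abs_real_inner_le_norm _ _).trans ?_
    gcongr
    exact norm_le_sqrt_mul_of_abs_le hη (h i)
  refine (norm_le_sqrt_mul_of_abs_le (by positivity) hrow).trans (le_of_eq ?_)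
  rw [mul_assoc (√d), ← mul_assoc, Real.mul_self_sqrt (Nat.cast_nonneg d), mul_assoc]

/-! ### The convergence of the iteration -/

/-- Bounds on the distance to the minimizer in the course of the iteration. -/
noncomputable def radius (μ M ε δ₀ : ℝ) : ℕ → ℝ
  | 0 => δ₀
  | n + 1 => M / (2 * μ) * radius μ M ε δ₀ n ^ 2 + ε

section Radius

variable {μ M ε δ₀ : ℝ}

theorem le_deltaMinus (hμ : 0 < μ) (hM : 0 < M) (hε : 0 < ε) (h : 2 * M / μ * ε < 1) :
    ε ≤ deltaMinus μ M ε := by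
  have hx : 0 < 2 * M / μ * ε := by positivity
  set x := 2 * M / μ * ε with hxd
  have h1 : √(1 - x) ≤ 1 - x / 2 := by
    rw [Real.sqrt_le_left (by linarith)]
    nlinarith
  have e : ε = μ / M * (x / 2) := by rw [hxd]; field_simp
  rw [deltaMinus, ← hxd]
  nth_rewrite 1 [e]
  gcongr
  linarith

theorem deltaTilde_lt (hμ : 0 < μ) (hM : 0 < M) (h : 2 * M / μ * ε < 1) (h0 : δ₀ < μ / M) :
    deltaTilde μ M ε δ₀ < μ / M := by
  refine max_lt h0 ?_
  have : 0 < √(1 - 2 * M / μ * ε) := Real.sqrt_pos.2 (by linarith)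
  have : 0 < μ / M := by positivity
  unfold deltaMinus
  nlinarith

theorem radius_nonneg (hμ : 0 < μ) (hM : 0 < M) (hε : 0 < ε) (h0 : 0 ≤ δ₀) (n : ℕ) :
    0 ≤ radius μ M ε δ₀ n := by
  cases n with
  | zero => exact h0
  | succ n => unfold radius; positivity

/-- With `u = MD/μ` and `s² = 1 - 2Mε/μ`, the fixed points of the recursion are `1 ± s`. From `1 - s
≤ u < 1` follows `(1 - u)² ≤ s²`, so the increasing map sends `[0, D]` into itself. -/
theorem radius_le_deltaTilde (hμ : 0 < μ) (hM : 0 < M) (hε : 0 < ε) (h : 2 * M / μ * ε < 1)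
    (h0 : 0 ≤ δ₀) (h1 : δ₀ < μ / M) (n : ℕ) : radius μ M ε δ₀ n ≤ deltaTilde μ M ε δ₀ := by
  induction n with
  | zero => exact le_max_left _ _
  | succ n ih =>
    set D := deltaTilde μ M ε δ₀ with hD
    have hDlt : D < μ / M := deltaTilde_lt hμ hM h h1
    have hr := radius_nonneg hμ hM hε h0 n
    have hDm : deltaMinus μ M ε ≤ D := le_max_right _ _
    set s := √(1 - 2 * M / μ * ε) with hs
    have hs2 : s ^ 2 = 1 - 2 * M / μ * ε := Real.sq_sqrt (by linarith)
    have hs0 : 0 ≤ s := Real.sqrt_nonneg _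
    set u := M / μ * D with hu
    have hDu : D = μ / M * u := by rw [hu]; field_simp
    have hu1 : u < 1 := by
      rw [hDu] at hDlt
      have : 0 < μ / M := by positivity
      nlinarith
    have hu2 : 1 - s ≤ u := by
      have : M / μ * deltaMinus μ M ε ≤ u := by rw [hu]; gcongr
      rw [deltaMinus, ← mul_assoc, show M / μ * (μ / M) = 1 by field_simp, one_mul] at this
      exact this
    have hε' : ε = μ / M * ((1 - s ^ 2) / 2) := by rw [hs2]; field_simp; ring
    calc radius μ M ε δ₀ (n + 1) = M / (2 * μ) * radius μ M ε δ₀ n ^ 2 + ε := rfl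
      _ ≤ M / (2 * μ) * D ^ 2 + ε := by gcongr
      _ = μ / M * ((u ^ 2 + 1 - s ^ 2) / 2) := by
          rw [hε', hDu]; field_simp; ring
      _ ≤ μ / M * u := by
          gcongr
          nlinarith
      _ = D := hDu.symm

/-- The normalized recursion averages `u²` and `η`, so it is bounded by their maximum; `η < 1` gives
`η² ≤ η` when `u ≤ η`. -/
theorem radius_le_max (hμ : 0 < μ) (hM : 0 < M) (hε : 0 < ε) (h : 2 * M / μ * ε < 1)
    (h0 : 0 ≤ δ₀) (n : ℕ) :
    M / μ * radius μ M ε δ₀ n ≤ max ((M / μ * δ₀) ^ (2 ^ n)) (2 * M / μ * ε) := by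
  induction n with
  | zero => simp [radius]
  | succ n ih =>
    have hr : 0 ≤ M / μ * radius μ M ε δ₀ n :=
      mul_nonneg (by positivity) (radius_nonneg hμ hM hε h0 n)
    have hη : 0 < 2 * M / μ * ε := by positivity
    have e : M / μ * radius μ M ε δ₀ (n + 1) =
        ((M / μ * radius μ M ε δ₀ n) ^ 2 + 2 * M / μ * ε) / 2 := by
      simp only [radius]; field_simp
    have h1 : (M / μ * radius μ M ε δ₀ n) ^ 2 ≤
        max ((M / μ * δ₀) ^ (2 ^ (n + 1))) (2 * M / μ * ε) := by
      rcases le_max_iff.1 ih with h' | h'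
      · refine le_max_of_le_left ?_
        rw [pow_succ 2 n, pow_mul]
        exact pow_le_pow_left₀ hr h' 2
      · refine le_max_of_le_right ?_
        nlinarith
    rw [e]
    have h2 := le_max_right ((M / μ * δ₀) ^ (2 ^ (n + 1))) (2 * M / μ * ε)
    linarith

theorem one_le_numIter (μ M ε δ₀ : ℝ) : 1 ≤ numIter μ M ε δ₀ := by
  unfold numIter
  have := le_max_right
    (⌈logb 2 (log (2 * M * ε / μ) / (2 * log (M * δ₀ / μ)))⌉ + 1) 1
  omega

theorem pow_numIter_le (hμ : 0 < μ) (hM : 0 < M) (hε : 0 < ε) (h : 2 * M / μ * ε < 1)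
    (h0 : 0 < δ₀) (h1 : δ₀ < μ / M) :
    (M / μ * δ₀) ^ (2 ^ numIter μ M ε δ₀) ≤ 2 * M / μ * ε := by
  have hη : 0 < 2 * M / μ * ε := by positivity
  have hu : 0 < M / μ * δ₀ := by positivity
  have hu1 : M / μ * δ₀ < 1 := by
    rw [lt_div_iff₀ hM] at h1
    rw [div_mul_eq_mul_div, div_lt_one hμ]
    linarith
  have hlu : log (M / μ * δ₀) < 0 := log_neg hu hu1
  have hle : log (2 * M / μ * ε) < 0 := log_neg hη h
  set n := numIter μ M ε δ₀ with hn
  set ρ := log (2 * M / μ * ε) / (2 * log (M / μ * δ₀)) with hρ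
  have hρ0 : 0 < ρ := div_pos_of_neg_of_neg hle (by linarith)
  have hn1 : logb 2 ρ + 1 ≤ n := by
    have e : (n : ℤ) = max (⌈logb 2 ρ⌉ + 1) 1 := by
      rw [hn, numIter, hρ, show 2 * M * ε / μ = 2 * M / μ * ε by ring,
        show M * δ₀ / μ = M / μ * δ₀ by ring]
      exact Int.toNat_of_nonneg (zero_le_one.trans (le_max_right _ _))
    have h2 : ⌈logb 2 ρ⌉ + 1 ≤ (n : ℤ) := e ▸ le_max_left _ _
    have h3 : ((⌈logb 2 ρ⌉ : ℤ) : ℝ) + 1 ≤ n := by exact_mod_cast h2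
    linarith [Int.le_ceil (logb 2 ρ)]
  -- The summand 1 in `numIter` supplies the factor 2, and `2ρ · log u₀ = log η`. Multiplying by the
  -- negative `log u₀` reverses the inequality.
  have h2 : 2 * ρ ≤ 2 ^ n := by
    have h3 : logb 2 (2 * ρ) ≤ n := by
      rw [logb_mul (by norm_num) hρ0.ne', logb_self_eq_one (by norm_num)]
      linarith
    rw [logb_le_iff_le_rpow (by norm_num) (by positivity)] at h3
    exact_mod_cast h3
  rw [← log_le_log_iff (by positivity) hη, log_pow]
  have h3 : log (2 * M / μ * ε) = 2 * ρ * log (M / μ * δ₀) := by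
    rw [hρ]
    have := hlu.ne
    generalize log (M / μ * δ₀) = b at *
    field_simp
  rw [h3]
  push_cast
  exact mul_le_mul_of_nonpos_right h2 hlu.le

theorem radius_numIter_le (hμ : 0 < μ) (hM : 0 < M) (hε : 0 < ε) (h : 2 * M / μ * ε < 1)
    (h0 : 0 ≤ δ₀) (h1 : δ₀ < μ / M) : radius μ M ε δ₀ (numIter μ M ε δ₀) ≤ 2 * ε := by
  have h2 : (M / μ * δ₀) ^ (2 ^ numIter μ M ε δ₀) ≤ 2 * M / μ * ε := by
    -- For `δ₀ = 0` the power vanishes, so the default values of the logarithms in `numIter` do not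
    -- matter.
    rcases h0.eq_or_lt with rfl | h0
    · rw [mul_zero, zero_pow (by positivity)]
      positivity
    · exact pow_numIter_le hμ hM hε h h0 h1
  have h3 := (radius_le_max hμ hM hε h h0 (numIter μ M ε δ₀)).trans (max_le h2 le_rfl)
  rw [show 2 * M / μ * ε = M / μ * (2 * ε) by ring] at h3
  exact le_of_mul_le_mul_left h3 (by positivity)

/-- The error of a Newton update for sufficiently good estimates. -/
theorem newton_error_le {σ δ D : ℝ} (hμ : 0 < μ) (hM : 0 < M) (hε : 0 < ε) (hδ : 0 ≤ δ)
    (hδD : δ ≤ D) (hεD : ε ≤ D) (hD : D < μ / M) (hσ : σ * D = μ * ε / 6) :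
    σ < μ ∧ (σ * δ + M / 2 * δ ^ 2 + μ * ε / 4) / (μ - σ) ≤ M / (2 * μ) * δ ^ 2 + ε := by
  have hD0 : 0 < D := hε.trans_le hεD
  have hσ0 : 0 < σ := by
    by_contra hn
    have := mul_nonpos_of_nonpos_of_nonneg (not_lt.1 hn) hD0.le
    have : 0 < μ * ε := by positivity
    linarith
  have hσμ : σ ≤ μ / 6 := by
    refine le_of_mul_le_mul_right ?_ hD0
    rw [hσ]
    nlinarith
  have hlt : σ < μ := by linarith
  refine ⟨hlt, ?_⟩
  rw [div_le_iff₀ (by linarith)]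
  have hMδ : M * δ ≤ μ := by
    rw [lt_div_iff₀ hM] at hD
    nlinarith
  -- After clearing the denominator, the contributions in units of `με` are `1/6 + 1/4 + 1/12 +
  -- 1/6`, which is less than 1.
  have h1 : σ * δ ≤ μ * ε / 6 := by rw [← hσ]; gcongr
  have h2 : M / (2 * μ) * δ ^ 2 * σ ≤ μ * ε / 12 := by
    calc M / (2 * μ) * δ ^ 2 * σ = (M * δ) * (σ * δ) / (2 * μ) := by ring
      _ ≤ μ * (μ * ε / 6) / (2 * μ) := by gcongr
      _ = _ := by field_simp; norm_num
  have h3 : M / (2 * μ) * δ ^ 2 * μ = M / 2 * δ ^ 2 := by field_simp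
  have h4 : ε * σ ≤ ε * (μ / 6) := by gcongr
  nlinarith

end Radius

/-! ### Numbers of oracle calls -/

/-- One call to `P_c` and one to the oracle of the derivative `t`. -/
def pairCalls {d : ℕ} (t : Target d) : Calls :=
  Gate.calls (.queryPar false : Gate d) + Gate.calls (.queryDeriv t false)

theorem circuitCalls_append {d : ℕ} (C C' : List (Gate d)) :
    circuitCalls (C ++ C') = circuitCalls C + circuitCalls C' := by
  simp [circuitCalls]

theorem circuitCalls_prepare {d : ℕ} (t : Target d) : circuitCalls (prepare t) = pairCalls t := by
  cases t <;> funext o <;> cases o <;> rfl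

theorem circuitCalls_grover {d : ℕ} (t : Target d) (n : ℕ) :
    circuitCalls (grover t n) = 2 • pairCalls t := by
  cases t <;> funext o <;> cases o <;> rfl

/-- One oracle pair for the initial `A`, and two for each use of `Q`, which contains `A⁻¹` and `A`.
-/
theorem circuitCalls_ampEst {d : ℕ} (t : Target d) (T : ℕ) :
    circuitCalls (ampEst t T) = (2 * T + 1) • pairCalls t := by
  have h : ∀ T, circuitCalls ((List.range T).flatMap (grover t)) = (2 * T) • pairCalls t := by
    intro T
    induction T with
    | zero => simp [circuitCalls]
    | succ T ih =>
      rw [List.range_succ, List.flatMap_append, circuitCalls_append, ih, List.flatMap_singleton,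
        circuitCalls_grover, ← add_smul]
      rfl
  have h0 : ∀ inv, circuitCalls [(Gate.fourierPhase inv : Gate d)] = 0 := by
    intro inv
    funext o
    rfl
  rw [ampEst, circuitCalls_append, circuitCalls_append, circuitCalls_append, h0, h0, h,
    circuitCalls_prepare, zero_add, add_zero, ← succ_nsmul']

/-- The oracle calls of one Newton update. -/
def stepCalls (d : ℕ) (P : Params) : Calls
  | .first => d * ((2 * P.repGrad + 1) * (2 * P.usesGrad + 1))
  | .second => d * (d * ((2 * P.repHess + 1) * (2 * P.usesHess + 1)))
  | .par => d * ((2 * P.repGrad + 1) * (2 * P.usesGrad + 1)) +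
      d * (d * ((2 * P.repHess + 1) * (2 * P.usesHess + 1)))

section Cost

variable {d p N : ℕ} [NeZero N] (f : Pt d → Par p → ℝ) (c : Fin N → Par p) (B : ℝ)

theorem costs_ampEstRun (t : Target d) (T : ℕ) (a : Pt d) :
    Costs (ampEstRun f c B t T a) ((2 * T + 1) • pairCalls t) := by
  rw [← circuitCalls_ampEst, ← add_zero (circuitCalls _)]
  exact (costs_modify _).bind fun _ => (costs_lift _).bind_pure

theorem costs_estimate (T s : ℕ) (a : Pt d) (t : Target d) :
    Costs (estimate f c B T s a t) ((2 * s + 1) • (2 * T + 1) • pairCalls t) :=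
  (costs_sampleVec fun _ => costs_ampEstRun f c B t T a).bind_pure

theorem costs_newtonStep (P : Params) (a : Pt d) :
    Costs (newtonStep f c B P a) (stepCalls d P) := by
  have e1 : ∀ i : Fin d, pairCalls (.first i) = fun | .par => 1 | .first => 1 | .second => 0 := by
    intro i
    funext o
    cases o <;> rfl
  have e2 : ∀ i j : Fin d,
      pairCalls (.second i j) = fun | .par => 1 | .first => 0 | .second => 1 := by
    intro i j
    funext o
    cases o <;> rfl
  have h1 := fun i => costs_estimate f c B P.usesGrad P.repGrad a (.first i)
  have h2 := fun i j => costs_estimate f c B P.usesHess P.repHess a (.second i j)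
  simp only [e1] at h1
  simp only [e2] at h2
  have e : stepCalls d P = d • (2 * P.repGrad + 1) • (2 * P.usesGrad + 1) •
        (fun | .par => 1 | .first => 1 | .second => 0 : Calls) +
      d • d • (2 * P.repHess + 1) • (2 * P.usesHess + 1) •
        (fun | .par => 1 | .first => 0 | .second => 1 : Calls) := by
    funext o
    cases o <;> simp [stepCalls]
  rw [e]
  exact (costs_sampleVec h1).bind fun g =>
    (costs_sampleVec fun i => costs_sampleVec (h2 i)).bind_pure

/-- Only an upper bound on the number of updates is certain, since a singular Hessian estimate stops
the run early. -/
theorem exists_calls_newtonIterate (P : Params) (n : ℕ) (a : Pt d) (s : Calls) :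
    ∀ x ∈ ((newtonIterate f c B P n a).run s).support,
      ∃ m ≤ n, x.2 = s + m • stepCalls d P := by
  induction n generalizing a s with
  | zero =>
    intro x hx
    rw [newtonIterate, mem_support_run_pure] at hx
    exact ⟨0, le_rfl, by simp [hx]⟩
  | succ n ih =>
    intro x hx
    rw [newtonIterate, mem_support_run_bind] at hx
    obtain ⟨⟨o, s'⟩, hy, hx⟩ := hx
    have hs' : s' = s + stepCalls d P := costs_newtonStep f c B P a s _ hy
    cases o with
    | none =>
      rw [mem_support_run_pure] at hx
      exact ⟨1, by omega, by simp [hx, hs']⟩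
    | some a' =>
      obtain ⟨m, hm, hxm⟩ := ih a' s' x hx
      exact ⟨m + 1, by omega, by rw [hxm, hs', add_assoc, succ_nsmul']⟩

end Cost

/-! ### The probability of success -/

section Success

theorem toOuterMeasure_gt_of_failLE {α : Type} {q : Comp α} {G : α → Prop} {b : ℝ≥0∞}
    (h : FailLE q G b) (hb : b < 1 / 100) (s : Calls) :
    (q.run s).toOuterMeasure {x | G x.1} > 99 / 100 := by
  classical
  have h1 : ∑' x, q.run s x = (q.run s).toOuterMeasure {x | G x.1} +
      expect q (fun x => if G x then 0 else 1) s := by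
    rw [PMF.toOuterMeasure_apply, expect, ← ENNReal.tsum_add]
    refine tsum_congr fun x => ?_
    by_cases hx : G x.1 <;> simp [Set.indicator, hx]
  rw [PMF.tsum_coe] at h1
  by_contra hn
  have h2 : (q.run s).toOuterMeasure {x | G x.1} ≤ 99 / 100 := not_lt.1 hn
  have h3 : (1 : ℝ≥0∞) < 99 / 100 + 1 / 100 := by
    calc (1 : ℝ≥0∞) ≤ 99 / 100 + b := h1.trans_le (add_le_add h2 (h s))
      _ < 99 / 100 + 1 / 100 :=
        ENNReal.add_lt_add_left (ENNReal.div_ne_top (by simp) (by simp)) hb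
  rw [ENNReal.div_add_div_same] at h3
  norm_num at h3
  rw [ENNReal.div_self (by simp) (by simp)] at h3
  exact lt_irrefl _ h3

variable {d p N : ℕ} [NeZero N] {f : Pt d → Par p → ℝ} {c : Fin N → Par p} {B μ M ε D : ℝ}
  {aStar : Pt d} {P : Params}

/-- The componentwise accuracies are the tolerances `με/4` and `με/(6D)` divided by the losses `√d`
for vectors and `d` for matrices. -/
theorem failLE_newtonStep (hd : 0 < d) (hμ : 0 < μ) (hM : 0 < M) (hε : 0 < ε) (hB : 0 < B)
    (hf : ∀ k, TwiceDifferentiable fun a => f a (c k)) (hc : StronglyConvex μ (objective f c))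
    (hL : LipschitzHessian M (objective f c))
    (hmin : ∀ a, objective f c aStar ≤ objective f c a)
    (hbd : ∀ (t : Target d) (a : Pt d) (k : Fin N), ‖a - aStar‖ ≤ D →
      |partialDeriv f t a (c k)| ≤ B)
    (hεD : ε ≤ D) (hD : D < μ / M) (hTg : 1 ≤ P.usesGrad) (hTH : 1 ≤ P.usesHess)
    (hg : 2 * π * B / (P.usesGrad + 1) ≤ μ * ε / (4 * √d))
    (hH : 2 * π * B / (P.usesHess + 1) ≤ μ * ε / (6 * d * D))
    {a : Pt d} {r : ℝ} (har : ‖a - aStar‖ ≤ r) (hr : r ≤ D) :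
    FailLE (newtonStep f c B P a)
      (fun o => ∃ a', o = some a' ∧ ‖a' - aStar‖ ≤ M / (2 * μ) * r ^ 2 + ε)
      (d * ENNReal.ofReal ((981 / 1000) ^ P.repGrad) +
        d * (d * ENNReal.ofReal ((981 / 1000) ^ P.repHess))) := by
  have hd' : (0 : ℝ) < d := by exact_mod_cast hd
  have hD0 : 0 < D := hε.trans_le hεD
  have haD := har.trans hr
  have e1 := fun i => failLE_estimate (s := P.repGrad) f c B hB hTg (.first i) a
    fun k => hbd _ a k haD
  have e2 := fun i j => failLE_estimate (s := P.repHess) f c B hB hTH (.second i j) a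
    fun k => hbd _ a k haD
  refine FailLE.bind (failLE_sampleVec e1) fun g hgi =>
    FailLE.bind_pure (failLE_sampleVec fun i => failLE_sampleVec (e2 i)) fun H hHi => ?_
  have hF := twiceDifferentiable_objective hf
  set σ := μ * ε / (6 * D) with hσ
  have hng : ‖WithLp.toLp 2 g - gradient (objective f c) a‖ ≤ μ * ε / 4 := by
    refine (norm_le_sqrt_mul_of_abs_le (η := μ * ε / (4 * √d)) (by positivity)
      fun i => ?_).trans (le_of_eq ?_)
    · rw [PiLp.sub_apply, gradient_objective_apply hf]
      exact (hgi i).trans hg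
    · have : √(d : ℝ) ≠ 0 := (Real.sqrt_pos.2 hd').ne'
      field_simp
  have hnH : ∀ x : Pt d, ‖WithLp.toLp 2 ((Matrix.of H).mulVec x) -
      hessian (objective f c) a x‖ ≤ σ * ‖x‖ := by
    intro x
    refine (norm_mulVec_sub_le (Matrix.of H) _ (η := μ * ε / (6 * d * D))
      (fun i j => ?_) x).trans (le_of_eq ?_)
    · rw [hessian_objective_apply hf]
      exact (hHi i j).trans hH
    · rw [hσ]
      field_simp
  obtain ⟨hσμ, herr⟩ := newton_error_le hμ hM hε (norm_nonneg (a - aStar)) haD hεD hD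
    (σ := σ) (by rw [hσ]; field_simp)
  obtain ⟨hu, hstep⟩ := newton_update hF hc hL hmin a g (Matrix.of H) hng hnH hσμ
  refine ⟨_, if_pos hu, (hstep.trans herr).trans ?_⟩
  gcongr

theorem failLE_newtonIterate {δ₀ : ℝ} {b : ℝ≥0∞}
    (hstep : ∀ n a, ‖a - aStar‖ ≤ radius μ M ε δ₀ n → FailLE (newtonStep f c B P a)
      (fun o => ∃ a', o = some a' ∧ ‖a' - aStar‖ ≤ radius μ M ε δ₀ (n + 1)) b)
    (n m : ℕ) {a : Pt d} (ha : ‖a - aStar‖ ≤ radius μ M ε δ₀ m) :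
    FailLE (newtonIterate f c B P n a)
      (fun o => ∃ a', o = some a' ∧ ‖a' - aStar‖ ≤ radius μ M ε δ₀ (m + n)) (n * b) := by
  induction n generalizing a m with
  | zero =>
    rw [Nat.cast_zero, zero_mul]
    exact FailLE.pure ⟨a, rfl, ha⟩
  | succ n ih =>
    have e : ((n + 1 : ℕ) : ℝ≥0∞) * b = b + n * b := by
      rw [Nat.cast_succ, add_mul, one_mul, add_comm]
    rw [newtonIterate, e]
    refine FailLE.bind (hstep m a ha) fun o ho => ?_
    obtain ⟨a', rfl, ha'⟩ := ho
    rw [← add_assoc, add_right_comm]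
    exact ih (m + 1) ha'

end Success

/-! ### Bounds implied by the hypotheses -/

section Bounds

variable {d p N : ℕ} [NeZero N] {f : Pt d → Par p → ℝ} {c : Fin N → Par p} {B μ D : ℝ}
  {aStar : Pt d}

theorem abs_average_le {v : Fin N → ℝ} (h : ∀ k, |v k| ≤ B) : |1 / (N : ℝ) * ∑ k, v k| ≤ B := by
  have hN : (0 : ℝ) < N := by exact_mod_cast NeZero.pos N
  rw [abs_mul, abs_of_pos (by positivity), one_div_mul_eq_div, div_le_iff₀ hN]
  calc |∑ k, v k| ≤ ∑ k, |v k| := Finset.abs_sum_le_sum_abs _ _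
    _ ≤ ∑ _k : Fin N, B := Finset.sum_le_sum fun k _ => h k
    _ = B * N := by simp [mul_comm]

/-- At distance `D` from the minimizer, strong convexity forces a gradient of norm at least `μD`,
whose components are at most `B`. With `ε ≤ D` this gives `Y ≥ 1` in the main proof. -/
theorem mul_le_sqrt_mul_of_bound (hd : 0 < d) (hB : 0 < B) (hD : 0 ≤ D)
    (hf : ∀ k, TwiceDifferentiable fun a => f a (c k)) (hc : StronglyConvex μ (objective f c))
    (hmin : ∀ a, objective f c aStar ≤ objective f c a)
    (hbd : ∀ (t : Target d) (a : Pt d) (k : Fin N), ‖a - aStar‖ ≤ D →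
      |partialDeriv f t a (c k)| ≤ B) : μ * D ≤ √d * B := by
  set a := aStar + D • EuclideanSpace.single (⟨0, hd⟩ : Fin d) (1 : ℝ) with ha
  have hn : ‖a - aStar‖ = D := by
    rw [ha, add_sub_cancel_left, norm_smul, PiLp.norm_single, norm_one, mul_one,
      Real.norm_eq_abs, abs_of_nonneg hD]
  have h := hc.norm_gradient_sub a aStar
  rw [gradient_eq_zero_of_isMin hmin, sub_zero, hn] at h
  refine h.trans (norm_le_sqrt_mul_of_abs_le hB.le fun i => ?_)
  rw [gradient_objective_apply hf]
  exact abs_average_le fun k => hbd _ a k hn.le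

/-- A diagonal Hessian entry at the minimizer lies between `μ` and `B`. In the main proof this gives
`Z ≥ 1`. -/
theorem le_of_bound (hd : 0 < d) (hD : 0 ≤ D)
    (hf : ∀ k, TwiceDifferentiable fun a => f a (c k)) (hc : StronglyConvex μ (objective f c))
    (hbd : ∀ (t : Target d) (a : Pt d) (k : Fin N), ‖a - aStar‖ ≤ D →
      |partialDeriv f t a (c k)| ≤ B) : μ ≤ B := by
  have h := hc.inner_hessian (twiceDifferentiable_objective hf) aStar
    (EuclideanSpace.single (⟨0, hd⟩ : Fin d) (1 : ℝ))
  rw [EuclideanSpace.inner_single_right, hessian_objective_apply hf, PiLp.norm_single]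
    at h
  simp only [norm_one, one_pow, mul_one, one_mul, conj_trivial] at h
  exact h.trans ((le_abs_self _).trans
    (abs_average_le fun k => hbd _ aStar k (by simpa using hD)))

end Bounds

/-! ### The parameters -/

/-- A number of repetitions for which `x` estimates are correct with high probability. -/
noncomputable def repetitions (x : ℝ) : ℕ := ⌈60 * log (300 * x)⌉₊

theorem pow_repetitions_le {x : ℝ} (hx : 1 ≤ x) :
    (981 / 1000 : ℝ) ^ repetitions x ≤ 1 / (300 * x) := by
  have h0 : 0 < 300 * x := by linarith
  have hl : 0 ≤ log (300 * x) := log_nonneg (by linarith)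
  have h1 : 60 * log (300 * x) ≤ repetitions x := Nat.le_ceil _
  rw [← log_le_log_iff (by positivity) (by positivity), log_pow, one_div, log_inv]
  -- The factor 60 in `repetitions` works because `60 · 0.019 > 1`.
  have h2 : log (981 / 1000) ≤ -(19 / 1000) := by
    have := log_le_sub_one_of_pos (show (0 : ℝ) < 981 / 1000 by norm_num)
    linarith
  calc (repetitions x : ℝ) * log (981 / 1000) ≤ repetitions x * (-(19 / 1000)) := by gcongr
    _ ≤ -log (300 * x) := by linarith

/-- With `log 300 ≤ 6` the left side is at most `723 + 120 log x`, and `723 + 120 = 843`. -/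
theorem repetitions_le {x : ℝ} (hx : 1 ≤ x) :
    (2 * repetitions x + 1 : ℝ) ≤ 843 * max 1 (log x) := by
  have h0 : 0 ≤ log x := log_nonneg hx
  have h1 : log (300 * x) = log 300 + log x := log_mul (by norm_num) (by linarith)
  have h2 : log 300 ≤ 6 := by
    rw [log_le_iff_le_exp (by norm_num)]
    have h3 : (2.7 : ℝ) ^ 6 ≤ exp 1 ^ 6 := by
      gcongr
      linarith [exp_one_gt_d9]
    rw [← exp_nat_mul] at h3
    norm_num at h3 ⊢
    linarith
  have h3 : (0 : ℝ) ≤ log 300 := log_nonneg (by norm_num)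
  have h4 : (repetitions x : ℝ) < 60 * log (300 * x) + 1 :=
    Nat.ceil_lt_add_one (by rw [h1]; positivity)
  have h5 := le_max_left 1 (log x)
  have h6 := le_max_right 1 (log x)
  rw [h1] at h4
  linarith

theorem two_mul_ceil_add_one_le {k y : ℝ} (hk : 0 ≤ k) (hy : 1 ≤ y) :
    (2 * ⌈k * y⌉₊ + 1 : ℝ) ≤ (2 * k + 3) * y := by
  have := Nat.ceil_lt_add_one (show 0 ≤ k * y by positivity)
  linarith

theorem div_ceil_add_one_le {x y z : ℝ} (hz : 0 < z) (hy : x / z ≤ y) :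
    x / (⌈y⌉₊ + 1) ≤ z := by
  rw [div_le_iff₀ hz] at hy
  rw [div_le_iff₀ (by positivity)]
  have := Nat.le_ceil y
  nlinarith

end QAENewton

/-! ### The main theorem -/

open QAENewton
theorem theorem2 :
    ∃ K : ℝ, 0 < K ∧
      ∀ (d : ℕ) (μ M ε δ₀ B : ℝ), 0 < d → 0 < μ → 0 < M → 0 < ε → 0 < B →
        2 * M / μ * ε < 1 → δ₀ < μ / M →
      ∃ P : Params,
        ∀ (p N : ℕ) [NeZero N] (f : Pt d → Par p → ℝ) (c : Fin N → Par p) (aStar a₀ : Pt d),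
          (∀ k, TwiceDifferentiable fun a => f a (c k)) →
          StronglyConvex μ (objective f c) →
          LipschitzHessian M (objective f c) →
          (∀ a, objective f c aStar ≤ objective f c a) →
          ‖a₀ - aStar‖ = δ₀ →
          (∀ (t : Target d) (a : Pt d) (k : Fin N), ‖a - aStar‖ ≤ deltaTilde μ M ε δ₀ →
            |partialDeriv f t a (c k)| ≤ B) →
          (newtonLaw f c B P (numIter μ M ε δ₀) a₀).toOuterMeasure
              {x | ∃ a, x.1 = some a ∧ ‖a - aStar‖ ≤ 2 * ε} > 99 / 100 ∧
          ∀ x ∈ (newtonLaw f c B P (numIter μ M ε δ₀) a₀).support,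
            (x.2 .first : ℝ) ≤ K * (B * (d : ℝ) ^ (3 / 2 : ℝ) / (μ * ε)) *
              numIter μ M ε δ₀ * max 1 (log (numIter μ M ε δ₀ * (d : ℝ) ^ 2)) ∧
            (x.2 .second : ℝ) ≤ K * (B * deltaTilde μ M ε δ₀ * (d : ℝ) ^ 3 / (μ * ε)) *
              numIter μ M ε δ₀ * max 1 (log (numIter μ M ε δ₀ * (d : ℝ) ^ 2)) ∧
            x.2 .par = x.2 .first + x.2 .second := by
  -- The constant has to exceed `843 · 54` and `843 · 79`, the products of repetitions and oracle
  -- pairs per run.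
  refine ⟨100000, by norm_num, fun d μ M ε δ₀ B hd hμ hM hε hB hη hδ => ?_⟩
  set D := deltaTilde μ M ε δ₀ with hD
  set n := numIter μ M ε δ₀ with hn
  have hεD : ε ≤ D := (le_deltaMinus hμ hM hε hη).trans (le_max_right _ _)
  have hD0 : 0 < D := hε.trans_le hεD
  have hDlt : D < μ / M := deltaTilde_lt hμ hM hη hδ
  have hd1 : (1 : ℝ) ≤ d := by exact_mod_cast hd
  have hd0 : (0 : ℝ) < d := by linarith
  have hn1 : (1 : ℝ) ≤ n := by exact_mod_cast one_le_numIter μ M ε δ₀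
  have hsq : 0 < √(d : ℝ) := Real.sqrt_pos.2 hd0
  have hnd : 1 ≤ n * (d : ℝ) ^ 2 := one_le_mul_of_one_le_of_one_le hn1 (one_le_pow₀ hd1)
  set Λ := max 1 (log (n * (d : ℝ) ^ 2)) with hΛ
  have hΛ0 : 0 ≤ Λ := zero_le_one.trans (le_max_left _ _)
  set s := repetitions (n * (d : ℝ) ^ 2) with hs
  have hsle : (2 * s + 1 : ℝ) ≤ 843 * Λ := repetitions_le hnd
  have hφ := pow_repetitions_le hnd
  rw [← hs] at hφ
  have hpi := pi_pos
  have hpi4 : π < 3.15 := pi_lt_d2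
  set Y := B * √d / (μ * ε) with hY
  set Z := B * d * D / (μ * ε) with hZ
  have hY0 : 0 < Y := by positivity
  have hZ0 : 0 < Z := by positivity
  -- Solving `2πB/T = με/(4√d)` and `2πB/T = με/(6dD)` for `T` gives `8πY` and `12πZ`.
  refine ⟨⟨⌈8 * π * Y⌉₊, s, ⌈12 * π * Z⌉₊, s⟩,
    fun p N _ f c aStar a₀ hf hc hL hmin ha₀ hbd => ⟨?_, fun x hx => ?_⟩⟩
  · have hδ0 : 0 ≤ δ₀ := ha₀ ▸ norm_nonneg _
    have hfail := failLE_newtonIterate (δ₀ := δ₀) (fun m a ham => failLE_newtonStep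
      (P := ⟨⌈8 * π * Y⌉₊, s, ⌈12 * π * Z⌉₊, s⟩) hd hμ hM hε hB hf hc hL hmin hbd hεD hDlt
      (Nat.one_le_ceil_iff.2 (by positivity)) (Nat.one_le_ceil_iff.2 (by positivity))
      (div_ceil_add_one_le (by positivity) (le_of_eq (by rw [hY]; field_simp; norm_num)))
      (div_ceil_add_one_le (by positivity) (le_of_eq (by rw [hZ]; field_simp; norm_num)))
      ham (radius_le_deltaTilde hμ hM hε hη hδ0 hδ m)) n 0 ha₀.le
    rw [zero_add] at hfail
    refine toOuterMeasure_gt_of_failLE (G := fun o => ∃ a, o = some a ∧ ‖a - aStar‖ ≤ 2 * ε)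
      (hfail.mono (fun o => ?_) le_rfl) ?_ 0
    · have himp : (∃ a', o = some a' ∧ ‖a' - aStar‖ ≤ radius μ M ε δ₀ n) →
          ∃ a', o = some a' ∧ ‖a' - aStar‖ ≤ 2 * ε :=
        fun ⟨a', h, h'⟩ => ⟨a', h, h'.trans (radius_numIter_le hμ hM hε hη hδ0 hδ)⟩
      split_ifs with h1 h2 <;> first | exact absurd (himp ‹_›) h1 | simp
    · have e : (n : ENNReal) * (d * ENNReal.ofReal ((981 / 1000) ^ s) +
          d * (d * ENNReal.ofReal ((981 / 1000) ^ s))) =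
          ENNReal.ofReal (n * (d * (981 / 1000) ^ s + d * (d * (981 / 1000) ^ s))) := by
        rw [ENNReal.ofReal_mul (by positivity), ENNReal.ofReal_add (by positivity)
          (by positivity), ENNReal.ofReal_mul (by positivity), ENNReal.ofReal_mul (by positivity),
          ENNReal.ofReal_mul (by positivity), ENNReal.ofReal_natCast, ENNReal.ofReal_natCast]
      have e2 : (1 / 100 : ENNReal) = ENNReal.ofReal (1 / 100) := by
        rw [ENNReal.ofReal_div_of_pos (by norm_num)]
        simp
      simp only
      rw [e, e2, ENNReal.ofReal_lt_ofReal_iff (by norm_num)]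
      have hdd : (d : ℝ) ≤ d ^ 2 := by nlinarith
      calc (n : ℝ) * (d * (981 / 1000) ^ s + d * (d * (981 / 1000) ^ s))
          = n * ((d + d ^ 2) * (981 / 1000) ^ s) := by ring
        -- There are `n(d + d²) ≤ 2nd²` estimates, each failing with probability at most
        -- `1/(300nd²)`.
        _ ≤ n * ((d ^ 2 + d ^ 2) * (1 / (300 * (n * d ^ 2)))) := by gcongr
        _ = 2 / 300 := by field_simp; norm_num
        _ < 1 / 100 := by norm_num
  · obtain ⟨m, hm, hxm⟩ := exists_calls_newtonIterate f c B _ n a₀ 0 x hx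
    rw [zero_add] at hxm
    have hm' : (m : ℝ) ≤ n := by exact_mod_cast hm
    have hY1 : 1 ≤ Y := by
      rw [hY, one_le_div (by positivity)]
      have h := mul_le_sqrt_mul_of_bound hd hB hD0.le hf hc hmin hbd
      nlinarith
    have hZ1 : 1 ≤ Z := by
      rw [hZ, one_le_div (by positivity)]
      have h := le_of_bound hd hD0.le hf hc hbd
      calc μ * ε ≤ B * D := by gcongr
        _ ≤ B * d * D := by nlinarith [mul_pos hB hD0]
    have hTg := two_mul_ceil_add_one_le (k := 8 * π) (by positivity) hY1
    have hTH := two_mul_ceil_add_one_le (k := 12 * π) (by positivity) hZ1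
    -- From `π < 3.15`: `16π + 3 < 54`, and below `24π + 3 < 79`.
    have hTg' : (2 * ⌈8 * π * Y⌉₊ + 1 : ℝ) ≤ 54 * Y := hTg.trans (by gcongr; linarith)
    have hTH' : (2 * ⌈12 * π * Z⌉₊ + 1 : ℝ) ≤ 79 * Z := hTH.trans (by gcongr; linarith)
    refine ⟨?_, ?_, ?_⟩
    · rw [hxm]
      simp only [Pi.smul_apply, stepCalls, smul_eq_mul]
      push_cast
      have hpow : (d : ℝ) ^ (3 / 2 : ℝ) = d * √d := by
        rw [show (3 / 2 : ℝ) = 1 + 1 / 2 by norm_num, rpow_add hd0, rpow_one, sqrt_eq_rpow]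
      calc (m : ℝ) * (d * ((2 * s + 1) * (2 * ⌈8 * π * Y⌉₊ + 1)))
          ≤ n * (d * ((843 * Λ) * (54 * Y))) := by gcongr
        _ = 45522 * (d * Y) * n * Λ := by ring
        _ ≤ 100000 * (d * Y) * n * Λ := by gcongr; norm_num
        _ = _ := by rw [hpow, hY]; ring
    · rw [hxm]
      simp only [Pi.smul_apply, stepCalls, smul_eq_mul]
      push_cast
      calc (m : ℝ) * (d * (d * ((2 * s + 1) * (2 * ⌈12 * π * Z⌉₊ + 1))))
          ≤ n * (d * (d * ((843 * Λ) * (79 * Z)))) := by gcongr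
        _ = 66597 * (d ^ 2 * Z) * n * Λ := by ring
        _ ≤ 100000 * (d ^ 2 * Z) * n * Λ := by gcongr; norm_num
        _ = _ := by rw [hZ]; ring
    · rw [hxm]
      simp only [Pi.smul_apply, stepCalls, smul_eq_mul]
      ring
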